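/- Let $(M^{2n},\omega)$ be a closed (compact, without boundary) smooth symplectic manifold. A symplectic isotopy of $(M,\omega)$ is a family $\psi_t$, $t\in[0,1]$, of symplectomorphisms of $(M,\omega)$, smooth in $(t,x)\in[0,1]\times M$, with $\psi_0=\mathrm{id}$. A Hamiltonian diffeomorphism of $(M,\omega)$ is the time-one map of the flow $\varphi_H^t$, $\frac{d}{dt}\varphi_H^t=X_{H_t}\circ\varphi_H^t$, $\varphi_H^0=\mathrm{id}$, of a smooth time-dependent Hamiltonian $H\colon \mathbb{R}/\mathbb{Z}\times M\to\mathbb{R}$, where $\omega(X_{H_t},\cdot)=-dH_t$. A symplectic isotopy $\phi_t$ is said to be obtained by a Hamiltonian deformation of a symplectic isotopy $\psi_t$ if $\phi_t\circ\psi_t^{-1}$ is a Hamiltonian diffeomorphism for every $t\in[0,1]$. A loop $\gamma\colon\mathbb{R}/\mathbb{Z}\to M$ is a hyperbolic one-periodic orbit of $\phi_1$, the time-one map of a symplectic isotopy $\phi_t$, if $\gamma(t)=\phi_t(\gamma(0))$ for all $t\in[0,1]$ (so that $\phi_1(\gamma(0))=\gamma(0)$) and no complex eigenvalue of $d(\phi_1)_{\gamma(0)}\colon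 T_{\gamma(0)}M\to T_{\gamma(0)}M$ has absolute value $1$. **Proposition 1.2.** Let $\psi_t$ be a symplectic isotopy of $(M,\omega)$ and let $\gamma\colon\mathbb{R}/\mathbb{Z}\to M$ be a smooth contractible loop. Then there exists a symplectic isotopy $\phi_t$ of $(M,\omega)$, obtained by a Hamiltonian deformation of $\psi_t$, such that $\gamma$ is a hyperbolic one-periodic orbit of $\phi_1$. -/

import Mathlib

open scoped Manifold ContDiff Topology

noncomputable section

namespace SymplecticIsotopy

variable {E : Type*} [NormedAddCommGroup E] [NormedSpace ℝ E]
  {M : Type*} [TopologicalSpace M] [ChartedSpace E M]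

/-- The expression of a field `Ω` of alternating bilinear forms on the tangent spaces of `M` in the
preferred chart at `x₀`: the pullback of `Ω` by the inverse of the chart. Only its values on the
(open) target of the chart are meaningful. -/
def inChart (Ω : ∀ x : M, (TangentSpace 𝓘(ℝ, E) x) [⋀^Fin 2]→L[ℝ] ℝ) (x₀ : M) (y : E) :
    E [⋀^Fin 2]→L[ℝ] ℝ :=
  (Ω ((chartAt E x₀).symm y)).compContinuousLinearMap
    (mfderiv 𝓘(ℝ, E) 𝓘(ℝ, E) (chartAt E x₀).symm y)

variable (E M) in
/-- A symplectic form on the manifold `M` modelled on `E`: a smooth, closed, nondegenerate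
differential two-form. Smoothness and closedness are expressed in the charts that cover `M`. -/
structure SymplecticForm where
  /-- the alternating bilinear form on each tangent space -/
  form : ∀ x : M, (TangentSpace 𝓘(ℝ, E) x) [⋀^Fin 2]→L[ℝ] ℝ
  smooth : ∀ x₀ : M, ContDiffOn ℝ ∞ (inChart form x₀) (chartAt E x₀).target
  closed : ∀ x₀ : M, ∀ y ∈ (chartAt E x₀).target, extDeriv (inChart form x₀) y = 0
  nondegenerate : ∀ (x : M) (u : TangentSpace 𝓘(ℝ, E) x),
    (∀ v : TangentSpace 𝓘(ℝ, E) x, form x ![u, v] = 0) → u = 0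

/-- `f` preserves the symplectic form: `f^* Ω = Ω`. -/
def IsSymplectic (Ω : SymplecticForm E M) (f : M → M) : Prop :=
  ∀ (x : M) (u v : TangentSpace 𝓘(ℝ, E) x),
    Ω.form (f x) ![mfderiv 𝓘(ℝ, E) 𝓘(ℝ, E) f x u, mfderiv 𝓘(ℝ, E) 𝓘(ℝ, E) f x v] =
      Ω.form x ![u, v]

/-- `ψ_t`, `t ∈ [0, 1]`, is a symplectic isotopy of `(M, Ω)`: a family of symplectomorphisms that
is smooth in `(t, x) ∈ [0, 1] × M`, with `ψ_0 = id`. The values of `ψ` at other times play no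
role. -/
structure IsSymplecticIsotopy (Ω : SymplecticForm E M)
    (ψ : ℝ → M ≃ₘ⟮𝓘(ℝ, E), 𝓘(ℝ, E)⟯ M) : Prop where
  smooth : ContMDiffOn (𝓘(ℝ, ℝ).prod 𝓘(ℝ, E)) 𝓘(ℝ, E) ∞ (fun q : ℝ × M => ψ q.1 q.2)
    (Set.Icc (0 : ℝ) 1 ×ˢ Set.univ)
  symplectic : ∀ t ∈ Set.Icc (0 : ℝ) 1, IsSymplectic Ω (ψ t)
  zero : ∀ x : M, ψ 0 x = x

/-- `X` is the Hamiltonian vector field of the function `h`: `Ω(X, ·) = -dh`. -/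
def IsHamiltonianVectorField (Ω : SymplecticForm E M) (h : M → ℝ)
    (X : ∀ x : M, TangentSpace 𝓘(ℝ, E) x) : Prop :=
  ∀ (x : M) (v : TangentSpace 𝓘(ℝ, E) x),
    Ω.form x ![X x, v] = -(mfderiv 𝓘(ℝ, E) 𝓘(ℝ, ℝ) h x v)

/-- `f` is a Hamiltonian diffeomorphism of `(M, Ω)`: it is the time-one map of the flow `φ_t` of the
time-dependent Hamiltonian vector field `X_{H_t}` of a smooth function `H` on `ℝ/ℤ × M`, written as
a smooth function on `ℝ × M` of period one in time. -/
def IsHamiltonianDiffeo (Ω : SymplecticForm E M) (f : M → M) : Prop :=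
  ∃ (H : ℝ → M → ℝ) (X : ℝ → ∀ x : M, TangentSpace 𝓘(ℝ, E) x) (φ : ℝ → M → M),
    ContMDiff (𝓘(ℝ, ℝ).prod 𝓘(ℝ, E)) 𝓘(ℝ, ℝ) ∞ (fun q : ℝ × M => H q.1 q.2) ∧
    (∀ t x, H (t + 1) x = H t x) ∧
    (∀ t, IsHamiltonianVectorField Ω (H t) (X t)) ∧
    (∀ x, φ 0 x = x) ∧
    (∀ t x, HasMFDerivAt 𝓘(ℝ, ℝ) 𝓘(ℝ, E) (fun s => φ s x) t
      ((1 : ℝ →L[ℝ] ℝ).smulRight (X t (φ t x)))) ∧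
    ∀ x, f x = φ 1 x

/-- `φ_t` is obtained from `ψ_t` by a Hamiltonian deformation: `φ_t ∘ ψ_t⁻¹` is a Hamiltonian
diffeomorphism for all `t ∈ [0, 1]`. -/
def IsHamiltonianDeformation (Ω : SymplecticForm E M)
    (φ ψ : ℝ → M ≃ₘ⟮𝓘(ℝ, E), 𝓘(ℝ, E)⟯ M) : Prop :=
  ∀ t ∈ Set.Icc (0 : ℝ) 1, IsHamiltonianDiffeo Ω (fun x => φ t ((ψ t).symm x))

/-- The differential `df_p` as an endomorphism of `T_p M`, for `p` a fixed point of `f`. -/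
def fixedPointDeriv (f : M → M) (p : M) (hp : f p = p) :
    TangentSpace 𝓘(ℝ, E) p →L[ℝ] TangentSpace 𝓘(ℝ, E) p :=
  Eq.mp (congrArg (fun q : M => TangentSpace 𝓘(ℝ, E) p →L[ℝ] TangentSpace 𝓘(ℝ, E) q) hp)
    (mfderiv 𝓘(ℝ, E) 𝓘(ℝ, E) f p)

variable (E) in
/-- `p` is a hyperbolic fixed point of `f`: no (complex) eigenvalue of `df_p` has absolute value
one. -/
def IsHyperbolicFixedPoint (f : M → M) (p : M) : Prop :=
  ∃ hp : f p = p, ∀ z : ℂ,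
    Module.End.HasEigenvalue
      (LinearMap.baseChange ℂ (fixedPointDeriv (E := E) f p hp).toLinearMap) z → ‖z‖ ≠ 1

/-- The loop `γ : ℝ/ℤ → M` is a hyperbolic one-periodic orbit of (the time-one map of) the isotopy
`φ_t`: it is the trajectory `t ↦ φ_t(γ(0))`, and `γ(0)` is a hyperbolic fixed point of `φ_1`. -/
def IsHyperbolicOnePeriodicOrbit (φ : ℝ → M ≃ₘ⟮𝓘(ℝ, E), 𝓘(ℝ, E)⟯ M)
    (γ : C(UnitAddCircle, M)) : Prop :=
  (∀ t ∈ Set.Icc (0 : ℝ) 1, γ (t : UnitAddCircle) = φ t (γ 0)) ∧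
    IsHyperbolicFixedPoint E (φ 1) (γ 0)

variable (E) in
/-- Smoothness of a loop `ℝ/ℤ → M`, as smoothness of the periodic map `ℝ → M`. -/
def IsSmoothLoop (γ : C(UnitAddCircle, M)) : Prop :=
  ContMDiff 𝓘(ℝ, ℝ) 𝓘(ℝ, E) ∞ (fun t : ℝ => γ (t : UnitAddCircle))

end SymplecticIsotopy

end

/-! Only the behaviour at the single point p = γ(0) matters. Choose smooth families of Hamiltonian
diffeomorphisms g_t, g'_t, b_t starting at the identity, with g_t(p) = ψ_t(p), g'_t(p) = γ(t) and
b_t(p) = p, and put φ_t = g'_t ∘ b_t ∘ g_t⁻¹ ∘ ψ_t. Then φ_t ∘ ψ_t⁻¹ is Hamiltonian and φ_t(p) =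
γ(t). At time one g'_1 and g_1⁻¹ ∘ ψ_1 fix p, with linear symplectic derivatives D' and C, so dφ_1
at p is D' ∘ B ∘ C, where B is the derivative of b_1. Taking B = D'⁻¹ ∘ D ∘ C⁻¹ makes it any
prescribed linear symplectic map D, for instance one annihilated by (X - 2)(X - 1/2)
(`exists_hyperbolic_linearEquiv`).

Two facts about Hamiltonian diffeomorphisms carry this. The first is that every smooth curve is
traced out by a Hamiltonian family (`exists_hamFamily_transport`). Since every tangent vector at q
is a value of some Hamiltonian vector field, composed flows give a family parametrised by a vector
space whose action on q is a local diffeomorphism (`exists_local_motion`); connectedness of [0, 1]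
then makes the local statement global. The second is that every linear symplectic map of the tangent
space at p is the derivative of a Hamiltonian diffeomorphism, in a family fixing p
(`isHamLinearization_of_preservesForm`). The symplectic group is generated by transvections
(`mem_closure_transvections`), and a transvection is the linearized time-one flow of a multiple of
f², where f(p) = 0.

The groundwork consists of smooth global flows on closed manifolds (`exists_flow`), invariance of
the form under Hamiltonian flows via Cartan's formula (`isSymplectic_hamFlow`), and closure of
Hamiltonian maps under composition. For the last point the generating paths are kept constant near
both ends, so that they can be concatenated and repeated periodically without losing smoothness. -/

noncomputable section
namespace SymplecticIsotopy

/-! ### Linear symplectic algebra: symplectic bases, transvections, a hyperbolic symplectic map. -/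

section LinearAlgebra

variable {V : Type*} [AddCommGroup V] [Module ℝ V]

/-- The linear maps preserving a bilinear form. -/
def PreservesForm (η : V →ₗ[ℝ] V →ₗ[ℝ] ℝ) (B : V → V) : Prop :=
  ∀ u v, η (B u) (B v) = η u v

/-- The symplectic transvections `x ↦ x + c η(v, x) v`. -/
def IsSymplecticTransvection (η : V →ₗ[ℝ] V →ₗ[ℝ] ℝ) (T : V ≃ₗ[ℝ] V) : Prop :=
  ∃ (v : V) (c : ℝ), ∀ x, T x = x + (c * η v x) • v

variable {η : V →ₗ[ℝ] V →ₗ[ℝ] ℝ}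

/-- A symplectic transvection as a linear equivalence. -/
def symplecticTransvection (hη : η.IsAlt) (v : V) (c : ℝ) : V ≃ₗ[ℝ] V :=
  LinearEquiv.ofLinearMap (LinearMap.id + (c • η v).smulRight v)
    (LinearMap.id - (c • η v).smulRight v)
    (by ext x; simp [hη.self_eq_zero])
    (by ext x; simp [hη.self_eq_zero])

lemma symplecticTransvection_apply (hη : η.IsAlt) (v : V) (c : ℝ) (x : V) :
    symplecticTransvection hη v c x = x + (c * η v x) • v := by
  simp [symplecticTransvection]

lemma isSymplecticTransvection_symplecticTransvection (hη : η.IsAlt) (v : V) (c : ℝ) :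
    IsSymplecticTransvection η (symplecticTransvection hη v c) :=
  ⟨v, c, symplecticTransvection_apply hη v c⟩

lemma form_neg_swap (hη : η.IsAlt) (u v : V) : η u v = -η v u := by
  rw [← hη.neg]

/-- If `η(u, w) ≠ 0` there is a transvection along `w - u` taking `u` to `w`. -/
lemma exists_transvection_apply_eq (hη : η.IsAlt) {u w : V} (h : η u w ≠ 0) :
    ∃ T ∈ Subgroup.closure {T : V ≃ₗ[ℝ] V | IsSymplecticTransvection η T},
      T u = w ∧ ∀ x, η x (w - u) = 0 → T x = x := by
  -- The scalar is forced: η(w - u, u) = η(w, u), so u moves by exactly w - u.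
  refine ⟨symplecticTransvection hη (w - u) (η w u)⁻¹,
    Subgroup.subset_closure (isSymplecticTransvection_symplecticTransvection hη _ _), ?_, ?_⟩
  · have h' : η w u ≠ 0 := by rw [form_neg_swap hη]; exact neg_ne_zero.2 h
    rw [symplecticTransvection_apply]
    simp [hη.self_eq_zero, inv_mul_cancel₀ h']
  · intro x hx
    rw [symplecticTransvection_apply, form_neg_swap hη (w - u) x, hx]
    simp

lemma preservesForm_of_mem_closure (hη : η.IsAlt) {T : V ≃ₗ[ℝ] V}
    (hT : T ∈ Subgroup.closure {T : V ≃ₗ[ℝ] V | IsSymplecticTransvection η T}) :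
    PreservesForm η T := by
  refine Subgroup.closure_induction (p := fun (T : V ≃ₗ[ℝ] V) _ => PreservesForm η T) ?_ ?_ ?_ ?_ hT
  · rintro T ⟨v, c, h⟩ a b
    rw [h, h]
    simp [hη.self_eq_zero, form_neg_swap hη a v]
    ring
  · intro a b; rfl
  · intro S T _ _ hS hT a b
    rw [LinearEquiv.mul_apply, LinearEquiv.mul_apply, hS, hT]
  · intro S _ hS a b
    rw [← hS]
    simp

/-- Two hyperbolic pairs are related by a product of transvections that fixes every vector
orthogonal to both pairs. -/
lemma exists_transvections_pair (hη : η.IsAlt) {e f x y : V} (hef : η e f = 1)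
    (hxy : η x y = 1) :
    ∃ T ∈ Subgroup.closure {T : V ≃ₗ[ℝ] V | IsSymplecticTransvection η T},
      T e = x ∧ T f = y ∧
        ∀ z, η z e = 0 → η z f = 0 → η z x = 0 → η z y = 0 → T z = z := by
  have step1 : ∃ T ∈ Subgroup.closure {T : V ≃ₗ[ℝ] V | IsSymplecticTransvection η T},
      T e = x ∧ ∀ z, η z e = 0 → η z f = 0 → η z x = 0 → η z y = 0 → T z = z := by
    by_cases h : η e x = 0
    -- When η(e, x) = 0 two transvections are needed, through an intermediate w. One of f, y, f + y
    -- always works, and staying in the span of f and y keeps vectors orthogonal to both pairs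
    -- fixed.
    · obtain ⟨w, hw1, hw2, hw⟩ : ∃ w, η e w ≠ 0 ∧ η w x ≠ 0 ∧
          ∀ z, η z f = 0 → η z y = 0 → η z w = 0 := by
        by_cases h1 : η x f = 0
        · by_cases h2 : η e y = 0
          · refine ⟨f + y, by simp [hef, h2], ?_, fun z h3 h4 => by simp [h3, h4]⟩
            rw [form_neg_swap hη]
            simp [h1, hxy]
          · refine ⟨y, h2, ?_, fun z h3 h4 => h4⟩
            rw [form_neg_swap hη]
            simp [hxy]
        · refine ⟨f, by simp [hef], ?_, fun z h3 h4 => h3⟩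
          rw [form_neg_swap hη]
          simpa using h1
      obtain ⟨T, hT, hT1, hT2⟩ := exists_transvection_apply_eq hη hw1
      obtain ⟨S, hS, hS1, hS2⟩ := exists_transvection_apply_eq hη hw2
      refine ⟨S * T, mul_mem hS hT, by simp [hT1, hS1], fun z h1 h2 h3 h4 => ?_⟩
      rw [LinearEquiv.mul_apply, hT2, hS2]
      · simp [h3, hw z h2 h4]
      · simp [h1, hw z h2 h4]
    · obtain ⟨T, hT, hT1, hT2⟩ := exists_transvection_apply_eq hη h
      exact ⟨T, hT, hT1, fun z h1 h2 h3 h4 => hT2 z (by simp [h1, h3])⟩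
  -- Moving f' to y does not disturb x, because the direction y - f' is orthogonal to x: both pair
  -- to 1 with it.
  have step2 : ∀ f' : V, η x f' = 1 →
      ∃ T ∈ Subgroup.closure {T : V ≃ₗ[ℝ] V | IsSymplecticTransvection η T},
      T x = x ∧ T f' = y ∧ ∀ z, η z x = 0 → η z f' = 0 → η z y = 0 → T z = z := by
    intro f' hf'
    by_cases h : η f' y = 0
    -- The detour goes through x + f', which also pairs to 1 with x, so both directions x and y - x
    -- - f' are orthogonal to x.
    · have h1 : η f' (x + f') ≠ 0 := by
        rw [map_add, hη.self_eq_zero, form_neg_swap hη, hf']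
        simp
      have h2 : η (x + f') y ≠ 0 := by
        simp [hxy, h]
      obtain ⟨T, hT, hT1, hT2⟩ := exists_transvection_apply_eq hη h1
      obtain ⟨S, hS, hS1, hS2⟩ := exists_transvection_apply_eq hη h2
      refine ⟨S * T, mul_mem hS hT, ?_, by simp [hT1, hS1], fun z h1 h2 h3 => ?_⟩
      · rw [LinearEquiv.mul_apply, hT2, hS2]
        · simp [hxy, hf', hη.self_eq_zero]
        · simp [hη.self_eq_zero]
      · rw [LinearEquiv.mul_apply, hT2, hS2]
        · simp [h1, h2, h3]
        · simp [h1]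
    · obtain ⟨T, hT, hT1, hT2⟩ := exists_transvection_apply_eq hη h
      exact ⟨T, hT, hT2 x (by simp [hxy, hf']), hT1, fun z h1 h2 h3 => hT2 z (by simp [h2, h3])⟩
  obtain ⟨T, hT, hT1, hT2⟩ := step1
  have hpres := preservesForm_of_mem_closure hη hT
  obtain ⟨S, hS, hS1, hS2, hS3⟩ := step2 (T f) (by rw [← hT1, hpres, hef])
  refine ⟨S * T, mul_mem hS hT, by simp [hT1, hS1], by simp [hS2], fun z h1 h2 h3 h4 => ?_⟩
  have hz := hT2 z h1 h2 h3 h4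
  rw [LinearEquiv.mul_apply, hz, hS3 z h3 (by rw [← hz, hpres, h2]) h4]

/-- The relations of a (partial) symplectic basis `e₁, …, e_k, f₁, …, f_k`. -/
structure IsSymplecticFamily (η : V →ₗ[ℝ] V →ₗ[ℝ] ℝ) {k : ℕ} (e f : Fin k → V) : Prop where
  ee : ∀ i j, η (e i) (e j) = 0
  ff : ∀ i j, η (f i) (f j) = 0
  ef : ∀ i j, η (e i) (f j) = if i = j then 1 else 0

lemma IsSymplecticFamily.linearIndependent {k : ℕ} {e f : Fin k → V}
    (h : IsSymplecticFamily η e f) : LinearIndependent ℝ e := by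
  rw [Fintype.linearIndependent_iff]
  intro g hg i
  have := congrArg (fun v => η v (f i)) hg
  simpa [h.ef] using this

/-- Every nondegenerate alternating form on a finite-dimensional space has a symplectic basis. -/
lemma exists_symplecticBasis [FiniteDimensional ℝ V] (hη : η.IsAlt)
    (hnd : ∀ u, (∀ v, η u v = 0) → u = 0) :
    ∃ (k : ℕ) (e f : Fin k → V), IsSymplecticFamily η e f ∧
      ∀ v, v = ∑ i, (η v (f i) • e i - η v (e i) • f i) := by
  classical
  let P : ℕ → Prop := fun k => ∃ e f : Fin k → V, IsSymplecticFamily η e f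
  have hP0 : P 0 := ⟨Fin.elim0, Fin.elim0, ⟨fun i => i.elim0, fun i => i.elim0, fun i => i.elim0⟩⟩
  have hbound : ∀ k, P k → k ≤ Module.finrank ℝ V := by
    rintro k ⟨e, f, h⟩
    simpa using h.linearIndependent.fintype_card_le_finrank
  have hk := Nat.findGreatest_spec (P := P) (Nat.zero_le (Module.finrank ℝ V)) hP0
  set k := Nat.findGreatest P (Module.finrank ℝ V) with hkdef
  obtain ⟨e, f, h⟩ := hk
  refine ⟨k, e, f, h, ?_⟩
  by_contra! hne
  obtain ⟨v, hv⟩ := hne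
  -- Q projects onto the orthogonal complement of a maximal symplectic family. A nonzero Q v, paired
  -- with a rescaled Q u, would enlarge the family.
  let Q : V → V := fun v => v - ∑ i, (η v (f i) • e i - η v (e i) • f i)
  have hfe : ∀ i j, η (f i) (e j) = -(if j = i then 1 else 0) := fun i j => by
    rw [form_neg_swap hη, h.ef]
  have hQe : ∀ v i, η (Q v) (e i) = 0 := fun v i => by
    simp [Q, h.ee, hfe]
  have hQf : ∀ v i, η (Q v) (f i) = 0 := fun v i => by
    simp [Q, h.ff, h.ef]
  have hQv : Q v ≠ 0 := sub_ne_zero.2 hv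
  obtain ⟨u, hu⟩ : ∃ u, η (Q v) u ≠ 0 := by
    by_contra! hu
    exact hQv (hnd _ hu)
  have hQQ : η (Q v) (Q u) = η (Q v) u := by
    have : Q u = u - ∑ i, (η u (f i) • e i - η u (e i) • f i) := rfl
    rw [this]
    simp [hQe, hQf]
  let w := (η (Q v) u)⁻¹ • Q u
  have hnew : P (k + 1) := by
    refine ⟨Fin.snoc e (Q v), Fin.snoc f w, ⟨?_, ?_, ?_⟩⟩
    · intro i j
      refine Fin.lastCases ?_ (fun i => ?_) i <;> refine Fin.lastCases ?_ (fun j => ?_) j <;>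
        simp [h.ee, hQe, hη.self_eq_zero]
      rw [form_neg_swap hη, hQe, neg_zero]
    · intro i j
      refine Fin.lastCases ?_ (fun i => ?_) i <;> refine Fin.lastCases ?_ (fun j => ?_) j <;>
        simp [h.ff, hQf, hη.self_eq_zero, w]
      right
      rw [form_neg_swap hη, hQf, neg_zero]
    · intro i j
      refine Fin.lastCases ?_ (fun i => ?_) i <;> refine Fin.lastCases ?_ (fun j => ?_) j
      · simp [w, hQQ, inv_mul_cancel₀ hu]
      · simp [hQf, (Fin.castSucc_lt_last j).ne']
      · simp [w, (Fin.castSucc_lt_last i).ne]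
        right
        rw [form_neg_swap hη, hQe, neg_zero]
      · simp [h.ef]
  have := Nat.le_findGreatest (hbound _ hnew) hnew
  omega

/-- The symplectic group is generated by transvections. -/
theorem mem_closure_transvections [FiniteDimensional ℝ V] (hη : η.IsAlt)
    (hnd : ∀ u, (∀ v, η u v = 0) → u = 0) (B : V ≃ₗ[ℝ] V) (hB : PreservesForm η B) :
    B ∈ Subgroup.closure {T : V ≃ₗ[ℝ] V | IsSymplecticTransvection η T} := by
  obtain ⟨k, e, f, h, hspan⟩ := exists_symplecticBasis hη hnd
  -- Match B on one hyperbolic pair at a time. If T agrees with B on the first m pairs, correct it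
  -- on the right by S sending the next pair to its image under T⁻¹B. As T⁻¹B preserves η and fixes
  -- the earlier pairs, these are orthogonal to both pairs involved, and S fixes them.
  have key : ∀ m : ℕ, ∃ T ∈ Subgroup.closure {T : V ≃ₗ[ℝ] V | IsSymplecticTransvection η T},
      ∀ i : Fin k, (i : ℕ) < m → T (e i) = B (e i) ∧ T (f i) = B (f i) := by
    intro m
    induction m with
    | zero => exact ⟨1, one_mem _, fun i hi => absurd hi (Nat.not_lt_zero _)⟩
    | succ m ih =>
      obtain ⟨T, hT, hTm⟩ := ih
      by_cases hm : m < k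
      · let j : Fin k := ⟨m, hm⟩
        have hTp := preservesForm_of_mem_closure hη (inv_mem hT)
        obtain ⟨S, hS, hS1, hS2, hS3⟩ := exists_transvections_pair hη
          (e := e j) (f := f j) (x := T⁻¹ (B (e j))) (y := T⁻¹ (B (f j)))
          (by rw [h.ef]; simp) (by rw [hTp, hB, h.ef]; simp)
        have hTinv : ∀ x, T (T⁻¹ x) = x := fun x => by
          rw [← LinearEquiv.mul_apply, mul_inv_cancel]; rfl
        have hTinv' : ∀ x, T⁻¹ (T x) = x := fun x => by
          rw [← LinearEquiv.mul_apply, inv_mul_cancel]; rfl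
        refine ⟨T * S, mul_mem hT hS, fun i hi => ?_⟩
        rcases Nat.lt_succ_iff_lt_or_eq.1 hi with hi | hi
        · have hij : i ≠ j := fun hij => by subst hij; simp [j] at hi
          obtain ⟨h1, h2⟩ := hTm i hi
          have h1' : T⁻¹ (B (e i)) = e i := by rw [← h1, hTinv']
          have h2' : T⁻¹ (B (f i)) = f i := by rw [← h2, hTinv']
          have hfe : η (f i) (e j) = 0 := by
            rw [form_neg_swap hη, h.ef, if_neg hij.symm, neg_zero]
          have hef : η (e i) (f j) = 0 := by rw [h.ef, if_neg hij]
          rw [LinearEquiv.mul_apply, LinearEquiv.mul_apply, hS3 (e i), hS3 (f i)]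
          · exact ⟨h1, h2⟩
          · exact hfe
          · exact h.ff i j
          · rw [← h2', hTp, hB, hfe]
          · rw [← h2', hTp, hB, h.ff]
          · exact h.ee i j
          · exact hef
          · rw [← h1', hTp, hB, h.ee]
          · rw [← h1', hTp, hB, hef]
        · have : i = j := Fin.ext hi
          subst this
          simp only [LinearEquiv.mul_apply, hS1, hS2, hTinv, and_self]
      · exact ⟨T, hT, fun i _ => hTm i (by omega)⟩
  obtain ⟨T, hT, hTk⟩ := key k
  have : B = T := by
    ext v
    rw [hspan v]
    simp only [map_sum, map_sub, map_smul]
    exact Finset.sum_congr rfl fun i _ => by rw [(hTk i i.2).1, (hTk i i.2).2]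
  exact this ▸ hT

/-- There is a symplectic linear map annihilated by `(X - 2)(X - 1/2)`. -/
lemma exists_hyperbolic_linearEquiv [FiniteDimensional ℝ V] (hη : η.IsAlt)
    (hnd : ∀ u, (∀ v, η u v = 0) → u = 0) :
    ∃ D : V ≃ₗ[ℝ] V, PreservesForm η D ∧
      ∀ v, D (D v) = (5 / 2 : ℝ) • D v - v := by
  obtain ⟨k, e, f, h, hspan⟩ := exists_symplecticBasis hη hnd
  have hfe : ∀ i j, η (f i) (e j) = -(if j = i then 1 else 0) := fun i j => by
    rw [form_neg_swap hη, h.ef]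
  -- On the symplectic basis, e_i goes to 2 e_i and f_i to f_i / 2; the factors multiply to 1, so η
  -- is preserved.
  let D₀ : V →ₗ[ℝ] V := ∑ i, ((2 : ℝ) • (η.flip (f i)).smulRight (e i) -
    (1 / 2 : ℝ) • (η.flip (e i)).smulRight (f i))
  have hD₀ : ∀ v, D₀ v = ∑ i, ((2 * η v (f i)) • e i - (1 / 2 * η v (e i)) • f i) := fun v => by
    simp [D₀, LinearMap.sum_apply, smul_smul]
  have hDf : ∀ v i, η (D₀ v) (f i) = 2 * η v (f i) := fun v i => by
    simp [hD₀, h.ef, h.ff]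
  have hDe : ∀ v i, η (D₀ v) (e i) = 1 / 2 * η v (e i) := fun v i => by
    simp [hD₀, h.ee, hfe]
  have hquad : ∀ v, D₀ (D₀ v) = (5 / 2 : ℝ) • D₀ v - v := fun v => by
    conv_rhs => rw [hD₀ v]; enter [2]; rw [hspan v]
    rw [hD₀ (D₀ v), Finset.smul_sum, ← Finset.sum_sub_distrib]
    refine Finset.sum_congr rfl fun i _ => ?_
    rw [hDf, hDe]
    module
  have hpres : PreservesForm η D₀ := fun u v => by
    conv_rhs => rw [hspan v]
    rw [hD₀ v]
    simp only [map_sum, map_sub, map_smul, hDf, hDe, smul_eq_mul]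
    exact Finset.sum_congr rfl fun i _ => by ring
  have hinj : Function.Injective D₀ := by
    rw [← LinearMap.ker_eq_bot, LinearMap.ker_eq_bot']
    intro u hu
    refine hnd u fun v => ?_
    rw [← hpres, hu]; simp
  exact ⟨LinearEquiv.ofInjectiveEndo D₀ hinj, fun u v => by simpa using hpres u v,
    fun v => by simpa using hquad v⟩

open TensorProduct in
/-- The complex eigenvalues of a real endomorphism annihilated by `(X - 2)(X - 1/2)` do not lie on
the unit circle. -/
lemma norm_ne_one_of_hasEigenvalue_baseChange {D : V →ₗ[ℝ] V}
    (hD : ∀ v, D (D v) = (5 / 2 : ℝ) • D v - v) {z : ℂ}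
    (hz : Module.End.HasEigenvalue (LinearMap.baseChange ℂ D) z) : ‖z‖ ≠ 1 := by
  obtain ⟨x, hx⟩ := hz.exists_hasEigenvector
  -- The quadratic relation survives complexification and confines every eigenvalue to the roots 2
  -- and 1/2.
  have hquad : ∀ x : ℂ ⊗[ℝ] V, LinearMap.baseChange ℂ D (LinearMap.baseChange ℂ D x) =
      (5 / 2 : ℂ) • LinearMap.baseChange ℂ D x - x := by
    intro x
    induction x with
    | zero => simp
    | tmul a v =>
      simp only [LinearMap.baseChange_tmul, hD, TensorProduct.tmul_sub, TensorProduct.tmul_smul]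
      congr 1
      rw [← algebraMap_smul ℂ (5 / 2 : ℝ)]
      simp
    | add x y hx hy => rw [map_add, map_add, hx, hy, smul_add]; abel
  have h1 := hquad x
  rw [hx.apply_eq_smul, map_smul, hx.apply_eq_smul, smul_smul, smul_smul] at h1
  have h2 : (z * z - (5 / 2 * z - 1)) • x = 0 := by
    rw [sub_smul, sub_smul, one_smul, h1, sub_self]
  have h3 : (z - 2) * (z - 1 / 2) = 0 := by
    rcases smul_eq_zero.1 h2 with h | h
    · rw [← h]; ring
    · exact absurd h hx.2
  rcases mul_eq_zero.1 h3 with h | h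
  · rw [sub_eq_zero.1 h]; norm_num
  · rw [sub_eq_zero.1 h]; norm_num

end LinearAlgebra

/-! ### Local flows in Banach spaces, by the implicit function theorem on a space of curves. -/

section LocalFlow

universe u

section Superposition

variable {K : Type*} [TopologicalSpace K] [CompactSpace K]
  {E F : Type*} [NormedAddCommGroup E] [NormedSpace ℝ E] [NormedAddCommGroup F] [NormedSpace ℝ F]

variable (K E F) in
/-- Pointwise application of a continuous family of linear maps, as a continuous linear map. -/
def pointwiseApply : C(K, E →L[ℝ] F) →L[ℝ] C(K, E) →L[ℝ] C(K, F) :=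
  LinearMap.mkContinuous₂
    (LinearMap.mk₂ ℝ (fun (A : C(K, E →L[ℝ] F)) (h : C(K, E)) =>
        (⟨fun t => A t (h t), A.continuous.clm_apply h.continuous⟩ : C(K, F)))
      (fun _ _ _ => by ext; simp) (fun _ _ _ => by ext; simp)
      (fun _ _ _ => by ext; simp) (fun _ _ _ => by ext; simp)) 1
    (fun A h => by
      rw [ContinuousMap.norm_le _ (by positivity)]
      intro t
      calc ‖A t (h t)‖ ≤ ‖A t‖ * ‖h t‖ := (A t).le_opNorm _
        _ ≤ 1 * ‖A‖ * ‖h‖ := by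
          rw [one_mul]
          gcongr
          · exact A.norm_coe_le_norm t
          · exact h.norm_coe_le_norm t)

/-- The superposition operator `α ↦ X ∘ α` of a `C¹` map `X` is differentiable. -/
lemma hasFDerivAt_superposition {X : E → F} (hX : ContDiff ℝ 1 X) (α : C(K, E)) :
    HasFDerivAt (fun β : C(K, E) => (⟨X, hX.continuous⟩ : C(E, F)).comp β)
      (pointwiseApply K E F ((⟨fderiv ℝ X, hX.continuous_fderiv one_ne_zero⟩ :
        C(E, E →L[ℝ] F)).comp α)) α := by
  rw [hasFDerivAt_iff_isLittleO, Asymptotics.isLittleO_iff]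
  intro ε hε
  -- Continuity of postcomposition with the derivative of X, in the sup norm, gives one δ valid at
  -- all points of K; the mean value inequality on each ball then gives the uniform estimate.
  have hc := (ContinuousMap.continuous_postcomp (X := K)
    (⟨fderiv ℝ X, hX.continuous_fderiv one_ne_zero⟩ : C(E, E →L[ℝ] F))).continuousAt (x := α)
  obtain ⟨δ, hδ, hball⟩ := (Metric.continuousAt_iff (α := C(K, E)) (β := C(K, E →L[ℝ] F))).1 hc ε hε
  filter_upwards [Metric.ball_mem_nhds α hδ] with β hβ
  rw [ContinuousMap.norm_le _ (by positivity)]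
  intro t
  have hαβ : ‖β t - α t‖ ≤ ‖β - α‖ := (β - α).norm_coe_le_norm t
  have hβt : β t ∈ Metric.ball (α t) δ := by
    rw [Metric.mem_ball, dist_eq_norm]
    exact hαβ.trans_lt (by rwa [← dist_eq_norm])
  have key := (convex_ball (α t) δ).norm_image_sub_le_of_norm_fderiv_le' (𝕜 := ℝ) (f := X)
    (φ := fderiv ℝ X (α t)) (C := ε) (x := α t) (y := β t)
    (fun z _ => hX.differentiable one_ne_zero z) (fun z hz => ?_)
    (Metric.mem_ball_self hδ) hβt
  · exact key.trans (by gcongr)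
  -- A translate of α by a constant passes through z at parameter t and stays δ-close to α, so the
  -- uniform bound applies at z.
  · have hz' : dist (α + ContinuousMap.const K (z - α t)) α < δ := by
      rw [dist_eq_norm, add_sub_cancel_left]
      refine lt_of_le_of_lt ((ContinuousMap.norm_le _ (norm_nonneg (z - α t))).2 fun s => le_rfl) ?_
      rwa [← dist_eq_norm]
    have h := (ContinuousMap.dist_apply_le_dist t).trans_lt (hball hz')
    rw [dist_eq_norm] at h
    simpa using h.le

end Superposition

/-- The superposition operator of a `Cⁿ` map is `Cⁿ`. -/
lemma contDiff_superposition {K : Type*} [TopologicalSpace K] [CompactSpace K] {E : Type u}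
    [NormedAddCommGroup E] [NormedSpace ℝ E] (n : ℕ) : ∀ {F : Type u} [NormedAddCommGroup F]
    [NormedSpace ℝ F] (X : C(E, F)), ContDiff ℝ n X →
      ContDiff ℝ n (fun β : C(K, E) => X.comp β) := by
  induction n with
  | zero =>
    intro F _ _ X _
    rw [Nat.cast_zero, contDiff_zero]
    exact ContinuousMap.continuous_postcomp X
  | succ n ih =>
    intro F _ _ X hX
    have h1 : ContDiff ℝ 1 X := hX.of_le (by exact_mod_cast Nat.succ_le_succ (Nat.zero_le n))
    have hd := fun α : C(K, E) => hasFDerivAt_superposition h1 α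
    rw [Nat.cast_add, Nat.cast_one, contDiff_succ_iff_fderiv] at hX ⊢
    refine ⟨fun α => (hd α).differentiableAt, by simp, ?_⟩
    have : fderiv ℝ (fun β : C(K, E) => X.comp β) = fun α => pointwiseApply K E F
        ((⟨fderiv ℝ X, h1.continuous_fderiv one_ne_zero⟩ : C(E, E →L[ℝ] F)).comp α) :=
      funext fun α => (hd α).fderiv
    rw [this]
    -- The derivative is again a superposition operator, with values in `E →L[ℝ] F`; this is why the
    -- induction quantifies over the target.
    exact (pointwiseApply K E F).contDiff.comp (ih
      (⟨fderiv ℝ X, h1.continuous_fderiv one_ne_zero⟩ : C(E, E →L[ℝ] F)) hX.2.2)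

variable {E : Type u} [NormedAddCommGroup E]

lemma continuous_extend (α : C(Set.Icc (-1 : ℝ) 1, E)) :
    Continuous fun r => α (Set.projIcc (-1) 1 (by norm_num) r) :=
  α.continuous.comp continuous_projIcc

variable [NormedSpace ℝ E]

/-- The primitive vanishing at `0` of a continuous function on `[-1, 1]`, extended by constants. -/
def primitiveFun (α : C(Set.Icc (-1 : ℝ) 1, E)) (t : ℝ) : E :=
  ∫ r in (0 : ℝ)..t, α (Set.projIcc (-1) 1 (by norm_num) r)

lemma hasDerivAt_primitiveFun [CompleteSpace E] (α : C(Set.Icc (-1 : ℝ) 1, E)) (t : ℝ) :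
    HasDerivAt (primitiveFun α) (α (Set.projIcc (-1) 1 (by norm_num) t)) t :=
  intervalIntegral.integral_hasDerivAt_right ((continuous_extend α).intervalIntegrable _ _)
    (continuous_extend α).aestronglyMeasurable.stronglyMeasurableAtFilter
    (continuous_extend α).continuousAt

variable (E) in
/-- The primitive operator on continuous functions on `[-1, 1]`. -/
def primitiveCLM [CompleteSpace E] : C(Set.Icc (-1 : ℝ) 1, E) →L[ℝ] C(Set.Icc (-1 : ℝ) 1, E) :=
  LinearMap.mkContinuous
    { toFun := fun α => ⟨fun t => primitiveFun α t,
        (continuous_iff_continuousAt.2 fun t =>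
          (hasDerivAt_primitiveFun α t).continuousAt).comp continuous_subtype_val⟩
      map_add' := fun α β => by
        ext t
        exact intervalIntegral.integral_add ((continuous_extend α).intervalIntegrable _ _)
          ((continuous_extend β).intervalIntegrable _ _)
      map_smul' := fun c α => by
        ext t
        exact intervalIntegral.integral_smul c _ } 1
    (fun α => by
      rw [ContinuousMap.norm_le _ (by positivity)]
      intro t
      refine (intervalIntegral.norm_integral_le_of_norm_le_const (C := ‖α‖)
        fun r _ => α.norm_coe_le_norm _).trans ?_
      rw [one_mul, sub_zero]
      exact mul_le_of_le_one_right (norm_nonneg _) (abs_le.2 t.2))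

/-- A smooth vector field has a local flow of class `Cⁿ`, jointly in time and space. -/
theorem exists_contDiffOn_localFlow [CompleteSpace E] {X : E → E} (hX : ContDiff ℝ ∞ X) (x₀ : E)
    (n : ℕ) : ∃ (Φ : ℝ × E → E) (ε : ℝ), 0 < ε ∧
      ContDiffOn ℝ n Φ (Metric.ball 0 ε ×ˢ Metric.ball x₀ ε) ∧
      ∀ x ∈ Metric.ball x₀ ε, Φ (0, x) = x ∧
        ∀ s ∈ Metric.ball (0 : ℝ) ε, HasDerivAt (fun s => Φ (s, x)) (X (Φ (s, x))) s := by
  let K := Set.Icc (-1 : ℝ) 1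
  let Xc : C(E, E) := ⟨X, hX.continuous⟩
  let cst : E →L[ℝ] C(K, E) := ContinuousLinearMap.const ℝ K
  -- Zeros of G are the curves α(t) = x + s ∫₀ᵗ X(α) on the fixed interval [-1, 1]: time is rescaled
  -- by s, so the flow at time s is α(1). At s = 0 the partial derivative in α is the identity.
  let G : (ℝ × E) × C(K, E) → C(K, E) := fun v =>
    v.2 - cst v.1.2 - v.1.1 • primitiveCLM E (Xc.comp v.2)
  have hG : ∀ m : ℕ, ContDiff ℝ m G := fun m => by
    have h1 : ContDiff ℝ m (fun β : C(K, E) => Xc.comp β) :=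
      contDiff_superposition m Xc (hX.of_le (by exact_mod_cast le_top))
    refine (contDiff_snd.sub (cst.contDiff.comp contDiff_fst.snd)).sub ?_
    exact contDiff_fst.fst.smul ((primitiveCLM E).contDiff.comp (h1.comp contDiff_snd))
  let u : (ℝ × E) × C(K, E) := ((0, x₀), cst x₀)
  have hGu : G u = 0 := by simp [G, u]
  have hder : (fderiv ℝ G u ∘L .inr ℝ (ℝ × E) C(K, E)) = ContinuousLinearMap.id ℝ _ := by
    have h1 : HasFDerivAt (fun a : C(K, E) => G (u.1, a))
        (fderiv ℝ G u ∘L .inr ℝ (ℝ × E) C(K, E)) u.2 :=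
      ((hG 1).differentiable one_ne_zero u).hasFDerivAt.comp u.2 (hasFDerivAt_prodMk_right u.1 u.2)
    have h2 : HasFDerivAt (fun a : C(K, E) => G (u.1, a)) (ContinuousLinearMap.id ℝ _) u.2 := by
      have : (fun a : C(K, E) => G (u.1, a)) = fun a => a - cst x₀ := by
        funext a; simp [G, u]
      rw [this]
      exact (hasFDerivAt_id _).sub_const _
    exact h1.unique h2
  have hinv : (fderiv ℝ G u ∘L .inr ℝ (ℝ × E) C(K, E)).IsInvertible := by
    rw [hder]
    exact ContinuousLinearMap.isInvertible_equiv (f := ContinuousLinearEquiv.refl ℝ _)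
  -- The order is raised to n + 1 because the implicit function theorem needs a nonzero order and n
  -- may be 0.
  have cdf : ContDiffAt ℝ ((n + 1 : ℕ) : ℕ∞ω) G u := (hG (n + 1)).contDiffAt
  have hn : ((n + 1 : ℕ) : ℕ∞ω) ≠ 0 := by exact_mod_cast Nat.succ_ne_zero n
  let A := cdf.implicitFunction hn hinv
  have hA : ContDiffAt ℝ ((n + 1 : ℕ) : ℕ∞ω) A (0, x₀) := cdf.contDiffAt_implicitFunction hn hinv
  have hA0 : A (0, x₀) = cst x₀ := cdf.implicitFunction_apply_self hn hinv
  have hsol : ∀ᶠ y in 𝓝 ((0 : ℝ), x₀), G (y, A y) = 0 := by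
    have := cdf.eventually_apply_implicitFunction hn hinv
    rwa [hGu] at this
  have huniq : ∀ᶠ v in 𝓝 u, G v = 0 → A v.1 = v.2 := by
    have := cdf.eventually_apply_eq_iff_implicitFunction hn hinv
    rw [hGu] at this
    exact this.mono fun v hv => hv.1
  obtain ⟨r, hr, hr'⟩ := Metric.eventually_nhds_iff.1 huniq
  have hclose : ∀ᶠ y in 𝓝 ((0 : ℝ), x₀), dist (A y) (cst x₀) < r := by
    have := hA.continuousAt
    rw [ContinuousAt, hA0] at this
    exact this.eventually (Metric.ball_mem_nhds _ hr)
  have hsmooth : ∀ᶠ y in 𝓝 ((0 : ℝ), x₀), ContDiffAt ℝ ((n + 1 : ℕ) : ℕ∞ω) A y :=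
    hA.eventually (by exact_mod_cast WithTop.coe_ne_top)
  obtain ⟨δ, hδ, hδ'⟩ := Metric.eventually_nhds_iff.1 (hsol.and (hclose.and hsmooth))
  let ε := min δ r / 2
  have hε : 0 < ε := by positivity
  have hεδ : ε < δ := lt_of_lt_of_le (half_lt_self (by positivity)) (min_le_left _ _)
  have hεr : ε < r := lt_of_lt_of_le (half_lt_self (by positivity)) (min_le_right _ _)
  let ev : C(K, E) →L[ℝ] E := ContinuousMap.evalCLM ℝ (⟨1, by norm_num, le_rfl⟩ : K)
  have hmem : ∀ {s : ℝ} {x : E}, |s| ≤ ε → x ∈ Metric.ball x₀ ε →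
      dist (s, x) ((0 : ℝ), x₀) < δ := fun {s x} hs hx => by
    rw [Prod.dist_eq, max_lt_iff]
    exact ⟨by simpa using hs.trans_lt hεδ, (Metric.mem_ball.1 hx).trans hεδ⟩
  have hpt : ∀ {s : ℝ} {x : E}, |s| ≤ ε → x ∈ Metric.ball x₀ ε → ∀ t : K,
      A (s, x) t = x + s • primitiveFun (Xc.comp (A (s, x))) t := fun {s x} hs hx t => by
    have := DFunLike.congr_fun (hδ' (hmem hs hx)).1 t
    simp only [G, ContinuousMap.sub_apply, ContinuousMap.smul_apply,
      ContinuousMap.zero_apply] at this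
    rw [sub_sub, sub_eq_zero] at this
    exact this
  -- rescaling time: the solution at time `l * ε` is the restriction of the solution at time `ε`
  have hscale : ∀ x ∈ Metric.ball x₀ ε, ∀ l : K, ∀ t : K,
      A (l * ε, x) t = A (ε, x) ⟨l * t, by
        constructor <;> nlinarith [l.2.1, l.2.2, t.2.1, t.2.2]⟩ := by
    intro x hx l
    let μ : C(K, K) := ⟨fun t => ⟨l * t, by
        constructor <;> nlinarith [l.2.1, l.2.2, t.2.1, t.2.2]⟩, by fun_prop⟩
    have hεε : |ε| ≤ ε := (abs_of_pos hε).le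
    have hlε : |(l : ℝ) * ε| ≤ ε := by
      rw [abs_mul, abs_of_pos hε]
      exact mul_le_of_le_one_left hε.le (abs_le.2 l.2)
    have hd : dist (((l : ℝ) * ε, x), (A (ε, x)).comp μ) u < r := by
      rw [Prod.dist_eq, Prod.dist_eq, max_lt_iff, max_lt_iff]
      refine ⟨⟨by simpa [u] using hlε.trans_lt hεr, (Metric.mem_ball.1 hx).trans hεr⟩, ?_⟩
      rw [ContinuousMap.dist_lt_iff hr]
      intro t
      have h := (hδ' (hmem hεε hx)).2.1
      rw [ContinuousMap.dist_lt_iff hr] at h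
      exact h (μ t)
    -- The substitution r ↦ l r shows that the reparametrized curve solves the equation for time l
    -- ε; local uniqueness of the implicit function does the rest.
    have hz : G (((l : ℝ) * ε, x), (A (ε, x)).comp μ) = 0 := by
      ext t
      have h1 : primitiveFun (Xc.comp (A (ε, x))) (l * t) =
          (l : ℝ) • primitiveFun (Xc.comp ((A (ε, x)).comp μ)) t := by
        have h2 := intervalIntegral.smul_integral_comp_mul_left (a := 0) (b := (t : ℝ))
          (fun r => (Xc.comp (A (ε, x))) (Set.projIcc (-1) 1 (by norm_num) r)) (l : ℝ)
        rw [mul_zero] at h2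
        rw [primitiveFun, ← h2, primitiveFun]
        congr 1
        refine intervalIntegral.integral_congr fun r hr => ?_
        have hr1 : r ∈ K := by
          have := t.2
          rcases le_total 0 (t : ℝ) with h0 | h0
          · rw [Set.uIcc_of_le h0] at hr
            exact ⟨by linarith [hr.1], hr.2.trans this.2⟩
          · rw [Set.uIcc_of_ge h0] at hr
            exact ⟨this.1.trans hr.1, by linarith [hr.2]⟩
        have hr2 : (l : ℝ) * r ∈ K := by
          constructor <;> nlinarith [l.2.1, l.2.2, hr1.1, hr1.2]
        simp only [ContinuousMap.comp_apply]
        rw [Set.projIcc_of_mem _ hr1, Set.projIcc_of_mem _ hr2]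
        rfl
      have h3 := hpt hεε hx (μ t)
      have h4 : ((μ t : K) : ℝ) = l * t := rfl
      rw [h4, h1] at h3
      change A (ε, x) (μ t) - x - ((l : ℝ) * ε) • primitiveFun (Xc.comp ((A (ε, x)).comp μ)) t = 0
      rw [h3, mul_comm, mul_smul]
      abel
    have := hr' hd hz
    intro t
    exact DFunLike.congr_fun this t
  refine ⟨fun y => ev (A y), ε, hε, ?_, ?_⟩
  · intro y hy
    have := (hδ' (hmem (s := y.1) (x := y.2) (by simpa using (Metric.mem_ball.1 hy.1).le) hy.2)).2.2
    exact ((ev.contDiff.contDiffAt.comp y this).of_le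
      (by exact_mod_cast Nat.le_succ n)).contDiffWithinAt
  · intro x hx
    have hΦ : ∀ s ∈ Metric.ball (0 : ℝ) ε, ∀ h : s / ε ∈ K,
        ev (A (s, x)) = A (ε, x) ⟨s / ε, h⟩ := by
      intro s hs h
      have := hscale x hx ⟨s / ε, h⟩ ⟨1, by norm_num, le_rfl⟩
      simp only [div_mul_cancel₀ _ hε.ne', mul_one] at this
      exact this
    have hin : ∀ s ∈ Metric.ball (0 : ℝ) ε, s / ε ∈ K := fun s hs => by
      rw [Metric.mem_ball, dist_zero_right, Real.norm_eq_abs] at hs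
      exact abs_le.1 (by rw [abs_div, abs_of_pos hε]; exact (div_le_one hε).2 hs.le)
    have hεε : |ε| ≤ ε := (abs_of_pos hε).le
    -- One curve, A(ε, x), now records the flow at all small times, so its time derivative comes
    -- from the fundamental theorem of calculus.
    have hform : ∀ s ∈ Metric.ball (0 : ℝ) ε, ev (A (s, x)) =
        x + ε • primitiveFun (Xc.comp (A (ε, x))) (s / ε) := fun s hs => by
      rw [hΦ s hs (hin s hs), hpt hεε hx]
    refine ⟨?_, fun s hs => ?_⟩
    · have := hform 0 (Metric.mem_ball_self hε)
      simpa [primitiveFun] using this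
    · have h1 : HasDerivAt (fun s : ℝ => x + ε • primitiveFun (Xc.comp (A (ε, x))) (s / ε))
          (ε • (ε⁻¹ • (Xc.comp (A (ε, x))) (Set.projIcc (-1) 1 (by norm_num) (s / ε)))) s := by
        refine HasDerivAt.const_add x (HasDerivAt.const_smul ε ?_)
        refine HasDerivAt.scomp (h := fun s : ℝ => s / ε) s (hasDerivAt_primitiveFun _ (s / ε)) ?_
        simpa [div_eq_mul_inv] using (hasDerivAt_id s).mul_const ε⁻¹
      rw [smul_inv_smul₀ hε.ne', Set.projIcc_of_mem _ (hin s hs)] at h1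
      have h2 := h1.congr_of_eventuallyEq (f₁ := fun s => ev (A (s, x)))
        (Filter.eventually_of_mem (Metric.isOpen_ball.mem_nhds hs) fun s hs => hform s hs)
      change HasDerivAt (fun s => ev (A (s, x))) (X (ev (A (s, x)))) s
      rw [hΦ s hs (hin s hs)]
      exact h2

end LocalFlow

/-! ### Global smooth flows on closed manifolds. -/

section Flow

universe u

variable {E : Type u} [NormedAddCommGroup E] [NormedSpace ℝ E]
  {M : Type*} [TopologicalSpace M] [ChartedSpace E M]

/-- The expression of a vector field in the preferred chart at `x₀`. -/
def coordField (X : ∀ x : M, TangentSpace 𝓘(ℝ, E) x) (x₀ : M) (y : E) : E :=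
  mfderiv 𝓘(ℝ, E) 𝓘(ℝ, E) (chartAt E x₀) ((chartAt E x₀).symm y) (X ((chartAt E x₀).symm y))

variable [IsManifold 𝓘(ℝ, E) ∞ M]

lemma contDiffOn_coordField {X : ∀ x : M, TangentSpace 𝓘(ℝ, E) x}
    (hX : ContMDiff 𝓘(ℝ, E) 𝓘(ℝ, E).tangent ∞ (fun x => (⟨x, X x⟩ : TangentBundle 𝓘(ℝ, E) M)))
    (x₀ : M) : ContDiffOn ℝ ∞ (coordField X x₀) (chartAt E x₀).target := by
  have h1 : ContMDiffOn 𝓘(ℝ, E) 𝓘(ℝ, E) ∞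
      (fun x => (trivializationAt E (TangentSpace 𝓘(ℝ, E)) x₀ ⟨x, X x⟩).2)
      (trivializationAt E (TangentSpace 𝓘(ℝ, E) : M → Type _) x₀).baseSet :=
    (Bundle.Trivialization.contMDiffOn_section_baseSet_iff (IB := 𝓘(ℝ, E)) (n := ∞) (s := X) _).1
      hX.contMDiffOn
  rw [TangentBundle.trivializationAt_baseSet] at h1
  rw [← contMDiffOn_iff_contDiffOn]
  refine ((h1.comp (contMDiffOn_chart_symm (I := 𝓘(ℝ, E)) (x := x₀)) fun y hy =>
    (chartAt E x₀).map_target hy)).congr fun y hy => ?_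
  rw [coordField, mfderiv_chartAt_eq_tangentCoordChange ((chartAt E x₀).map_target hy)]
  rfl

/-- A map into `M` is an integral curve of `X` near `s` as soon as it is so in a chart. -/
lemma hasMFDerivAt_chart_symm_comp {X : ∀ x : M, TangentSpace 𝓘(ℝ, E) x} {x₀ : M} {c : ℝ → E}
    {s : ℝ} (hc : HasDerivAt c (coordField X x₀ (c s)) s) (hs : c s ∈ (chartAt E x₀).target) :
    HasMFDerivAt 𝓘(ℝ, ℝ) 𝓘(ℝ, E) (fun s => (chartAt E x₀).symm (c s)) s
      ((1 : ℝ →L[ℝ] ℝ).smulRight (X ((chartAt E x₀).symm (c s)))) := by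
  have hsymm := (mdifferentiableAt_atlas_symm (I := 𝓘(ℝ, E))
    (chart_mem_atlas E x₀) hs).hasMFDerivAt
  have h1 := hsymm.comp s hc.hasFDerivAt.hasMFDerivAt
  refine h1.congr_mfderiv ?_
  refine ContinuousLinearMap.ext_ring ?_
  have hinv := (mdifferentiable_chart (I := 𝓘(ℝ, E)) x₀).symm_comp_deriv
    ((chartAt E x₀).map_target hs)
  rw [(chartAt E x₀).right_inv hs] at hinv
  have h2 := DFunLike.congr_fun hinv (X ((chartAt E x₀).symm (c s)))
  change mfderiv 𝓘(ℝ, E) 𝓘(ℝ, E) (chartAt E x₀).symm (c s) ((1 : ℝ) • coordField X x₀ (c s)) =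
    (1 : ℝ) • X ((chartAt E x₀).symm (c s))
  rw [one_smul, one_smul]
  exact h2

variable [FiniteDimensional ℝ E]

/-- Local flows of a smooth vector field on a manifold, of class `Cⁿ` in time and space. -/
lemma exists_local_flow {X : ∀ x : M, TangentSpace 𝓘(ℝ, E) x}
    (hX : ContMDiff 𝓘(ℝ, E) 𝓘(ℝ, E).tangent ∞ (fun x => (⟨x, X x⟩ : TangentBundle 𝓘(ℝ, E) M)))
    (x₀ : M) (n : ℕ) : ∃ ε > 0, ∃ U ∈ 𝓝 x₀, ∃ Ψ : ℝ × M → M,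
      ContMDiffOn (𝓘(ℝ, ℝ).prod 𝓘(ℝ, E)) 𝓘(ℝ, E) n Ψ (Set.Ioo (-ε) ε ×ˢ U) ∧
      ∀ x ∈ U, Ψ (0, x) = x ∧ IsMIntegralCurveOn (fun s => Ψ (s, x)) X (Set.Ioo (-ε) ε) := by
  set χ := chartAt E x₀ with hχ
  set z₀ := χ x₀ with hz₀
  have hz₀t : z₀ ∈ χ.target := mem_chart_target E x₀
  obtain ⟨r, hr, hrt⟩ := Metric.nhds_basis_closedBall.mem_iff.1 (χ.open_target.mem_nhds hz₀t)
  -- The coordinate field is meaningful only on the chart target; the cutoff gives a smooth field on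
  -- all of E that agrees with it near z₀.
  let g : ContDiffBump z₀ := ⟨r / 2, r, by positivity, by linarith⟩
  let Y : E → E := fun y => g y • coordField X x₀ y
  have hY : ContDiff ℝ ∞ Y := by
    rw [contDiff_iff_contDiffAt]
    intro y
    by_cases hy : y ∈ χ.target
    · exact g.contDiffAt.smul ((contDiffOn_coordField hX x₀).contDiffAt (χ.open_target.mem_nhds hy))
    · have h0 : Y =ᶠ[𝓝 y] fun _ => 0 := by
        have : (Metric.closedBall z₀ r)ᶜ ∈ 𝓝 y :=
          Metric.isClosed_closedBall.isOpen_compl.mem_nhds fun h => hy (hrt h)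
        filter_upwards [this] with w hw
        have : g w = 0 := g.zero_of_le_dist (by
          have h1 : ¬dist w z₀ ≤ r := hw
          exact (not_le.1 h1).le)
        simp [Y, this]
      exact contDiffAt_const.congr_of_eventuallyEq h0
  have hYX : ∀ y ∈ Metric.ball z₀ (r / 2), Y y = coordField X x₀ y := fun y hy => by
    have : g y = 1 := g.one_of_mem_closedBall (Metric.ball_subset_closedBall hy)
    simp [Y, this]
  obtain ⟨Φ, δ, hδ, hΦ, hΦ'⟩ := exists_contDiffOn_localFlow hY z₀ n
  have hcont : ContinuousAt Φ (0, z₀) := hΦ.continuousOn.continuousAt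
    (prod_mem_nhds (Metric.ball_mem_nhds _ hδ) (Metric.ball_mem_nhds _ hδ))
  have hnhds : Φ ⁻¹' Metric.ball z₀ (r / 2) ∈ 𝓝 ((0 : ℝ), z₀) := by
    refine hcont.preimage_mem_nhds ?_
    rw [(hΦ' z₀ (Metric.mem_ball_self hδ)).1]
    exact Metric.ball_mem_nhds _ (by positivity)
  obtain ⟨ε', hε', hsub⟩ := Metric.mem_nhds_iff.1 hnhds
  let ε := min δ ε'
  have hε : 0 < ε := lt_min hδ hε'
  have hball : ∀ {s : ℝ} {y : E}, s ∈ Set.Ioo (-ε) ε → y ∈ Metric.ball z₀ ε →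
      Φ (s, y) ∈ Metric.ball z₀ (r / 2) := fun {s y} hs hy => hsub (by
    rw [Metric.mem_ball, Prod.dist_eq, max_lt_iff]
    exact ⟨by simpa [abs_lt] using ⟨(neg_le_neg (min_le_right _ _)).trans_lt hs.1,
      hs.2.trans_le (min_le_right _ _)⟩, (Metric.mem_ball.1 hy).trans_le (min_le_right _ _)⟩)
  have hbt : Metric.ball z₀ (r / 2) ⊆ χ.target := fun y hy =>
    hrt (Metric.ball_subset_closedBall (Metric.ball_subset_ball (by linarith) hy))
  have hIoo : Set.Ioo (-ε) ε ⊆ Metric.ball (0 : ℝ) δ := fun s hs => by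
    rw [Metric.mem_ball, dist_zero_right, Real.norm_eq_abs, abs_lt]
    exact ⟨(neg_le_neg (min_le_left _ _)).trans_lt hs.1, hs.2.trans_le (min_le_left _ _)⟩
  refine ⟨ε, hε, χ.source ∩ χ ⁻¹' Metric.ball z₀ ε,
    Filter.inter_mem (chart_source_mem_nhds E x₀)
      ((χ.continuousAt (mem_chart_source E x₀)).preimage_mem_nhds (Metric.ball_mem_nhds _ hε)),
    fun q => χ.symm (Φ (q.1, χ q.2)), ?_, fun x hx => ⟨?_, fun s hs => ?_⟩⟩
  · have h1 : ContMDiffOn 𝓘(ℝ, E) 𝓘(ℝ, E) n χ.symm χ.target :=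
      (contMDiffOn_chart_symm (n := ∞)).of_le (by exact_mod_cast le_top)
    have h2 : ContMDiffOn 𝓘(ℝ, E) 𝓘(ℝ, E) n χ χ.source :=
      (contMDiffOn_chart (n := ∞)).of_le (by exact_mod_cast le_top)
    have h3 : ContMDiffOn (𝓘(ℝ, ℝ).prod 𝓘(ℝ, E)) 𝓘(ℝ, ℝ × E) n (fun q : ℝ × M => (q.1, χ q.2))
        (Set.Ioo (-ε) ε ×ˢ (χ.source ∩ χ ⁻¹' Metric.ball z₀ ε)) :=
      contMDiffOn_fst.prodMk_space (h2.comp contMDiffOn_snd fun q hq => hq.2.1)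
    refine h1.comp (hΦ.contMDiffOn.comp h3 fun q hq => ?_) fun q hq => hbt (hball hq.1 hq.2.2)
    exact ⟨hIoo hq.1, Metric.ball_subset_ball (min_le_left _ _) hq.2.2⟩
  · change χ.symm (Φ (0, χ x)) = x
    rw [(hΦ' (χ x) (Metric.ball_subset_ball (min_le_left _ _) hx.2)).1, χ.left_inv hx.1]
  · have h1 := (hΦ' (χ x) (Metric.ball_subset_ball (min_le_left _ _) hx.2)).2 s (hIoo hs)
    have h2 := hball hs hx.2
    rw [hYX _ h2] at h1
    exact (hasMFDerivAt_chart_symm_comp h1 (hbt h2)).hasMFDerivWithinAt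

variable [T2Space M] [CompactSpace M]

/-- A smooth vector field on a closed manifold has a global smooth flow. -/
theorem exists_flow {X : ∀ x : M, TangentSpace 𝓘(ℝ, E) x}
    (hX : ContMDiff 𝓘(ℝ, E) 𝓘(ℝ, E).tangent ∞
      (fun x => (⟨x, X x⟩ : TangentBundle 𝓘(ℝ, E) M))) :
    ∃ Θ : ℝ → M → M,
      ContMDiff (𝓘(ℝ, ℝ).prod 𝓘(ℝ, E)) 𝓘(ℝ, E) ∞ (fun q : ℝ × M => Θ q.1 q.2) ∧
      (∀ x, Θ 0 x = x) ∧ (∀ x, IsMIntegralCurve (fun s => Θ s x) X) ∧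
      ∀ s t x, Θ (s + t) x = Θ s (Θ t x) := by
  have hX1 : ContMDiff 𝓘(ℝ, E) 𝓘(ℝ, E).tangent 1
      (fun x => (⟨x, X x⟩ : TangentBundle 𝓘(ℝ, E) M)) := hX.of_le (by exact_mod_cast le_top)
  classical
  -- Compactness makes the existence time independent of the point. It may still depend on n, so
  -- smoothness is proved separately for each finite order.
  have hunif : ∀ n : ℕ, ∃ ε > 0, ∀ x₀ : M, ∃ U ∈ 𝓝 x₀, ∃ Ψ : ℝ × M → M,
      ContMDiffOn (𝓘(ℝ, ℝ).prod 𝓘(ℝ, E)) 𝓘(ℝ, E) n Ψ (Set.Ioo (-ε) ε ×ˢ U) ∧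
      ∀ x ∈ U, Ψ (0, x) = x ∧ IsMIntegralCurveOn (fun s => Ψ (s, x)) X (Set.Ioo (-ε) ε) := by
    intro n
    choose ε hε U hU Ψ hΨ hΨ' using fun x₀ : M => exists_local_flow hX x₀ n
    obtain ⟨t, ht⟩ := CompactSpace.elim_nhds_subcover (fun x => interior (U x))
      fun x => interior_mem_nhds.2 (hU x)
    obtain ⟨e, he, hle⟩ : ∃ e > 0, ∀ x ∈ t, e ≤ ε x := by
      clear ht
      induction t using Finset.induction_on with
      | empty => exact ⟨1, one_pos, by simp⟩
      | insert a t _ ih =>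
        obtain ⟨e, he, hle⟩ := ih
        refine ⟨min e (ε a), lt_min he (hε a), fun x hx => ?_⟩
        rcases Finset.mem_insert.1 hx with rfl | hx
        · exact min_le_right _ _
        · exact (min_le_left _ _).trans (hle x hx)
    refine ⟨e, he, fun x₀ => ?_⟩
    have hx₀ : x₀ ∈ ⋃ x ∈ t, interior (U x) := by rw [ht]; trivial
    simp only [Set.mem_iUnion] at hx₀
    obtain ⟨y, hyt, hy⟩ := hx₀
    have hsub : Set.Ioo (-e) e ⊆ Set.Ioo (-ε y) (ε y) :=
      Set.Ioo_subset_Ioo (neg_le_neg (hle y hyt)) (hle y hyt)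
    exact ⟨interior (U y), isOpen_interior.mem_nhds hy, Ψ y,
      (hΨ y).mono (Set.prod_mono hsub interior_subset),
      fun x hx => ⟨(hΨ' y x (interior_subset hx)).1, ((hΨ' y x (interior_subset hx)).2).mono hsub⟩⟩
  have hglob : ∀ x : M, ∃ c : ℝ → M, c 0 = x ∧ IsMIntegralCurve c X := by
    obtain ⟨ε, hε, h⟩ := hunif 0
    refine exists_isMIntegralCurve_of_isMIntegralCurveOn hX1 hε fun x => ?_
    obtain ⟨U, hU, Ψ, -, hΨ⟩ := h x
    exact ⟨fun s => Ψ (s, x), hΨ x (mem_of_mem_nhds hU)⟩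
  choose c hc0 hc using hglob
  have hadd : ∀ s t x, c x (s + t) = c (c x t) s := by
    intro s t x
    have := isMIntegralCurve_Ioo_eq_of_contMDiff_boundaryless (t₀ := 0) hX1
      ((hc x).comp_add t) (hc (c x t)) (by simp [hc0])
    exact congrFun this s
  refine ⟨fun s x => c x s, ?_, hc0, hc, hadd⟩
  rw [contMDiff_infty]
  intro n
  obtain ⟨ε, hε, h⟩ := hunif n
  have hsmall : ContMDiffOn (𝓘(ℝ, ℝ).prod 𝓘(ℝ, E)) 𝓘(ℝ, E) n (fun q : ℝ × M => c q.2 q.1)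
      (Set.Ioo (-ε) ε ×ˢ Set.univ) := by
    rintro ⟨s, x⟩ ⟨hs, -⟩
    obtain ⟨U, hU, Ψ, hΨ, hΨ'⟩ := h x
    have hmem : Set.Ioo (-ε) ε ×ˢ U ∈ 𝓝 (s, x) := prod_mem_nhds (isOpen_Ioo.mem_nhds hs) hU
    refine ((hΨ.contMDiffAt hmem).congr_of_eventuallyEq ?_).contMDiffWithinAt
    filter_upwards [hmem] with q hq
    have := isMIntegralCurveOn_Ioo_eqOn_of_contMDiff_boundaryless (t₀ := 0)
      (by constructor <;> linarith) hX1 ((hc q.2).isMIntegralCurveOn (Set.Ioo (-ε) ε))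
      (hΨ' q.2 hq.2).2 (by rw [hc0, (hΨ' q.2 hq.2).1])
    exact this hq.1
  have hall : ∀ N : ℕ, ContMDiffOn (𝓘(ℝ, ℝ).prod 𝓘(ℝ, E)) 𝓘(ℝ, E) n
      (fun q : ℝ × M => c q.2 q.1) (Set.Ioo (-((N + 1) * ε)) ((N + 1) * ε) ×ˢ Set.univ) := by
    intro N
    induction N with
    | zero => simpa using hsmall
    | succ N ih =>
      have hN : (0 : ℝ) < N + 2 := by positivity
      have hscale : ∀ a : ℝ, ContMDiffOn (𝓘(ℝ, ℝ).prod 𝓘(ℝ, E)) 𝓘(ℝ, ℝ) n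
          (fun q : ℝ × M => q.1 * a)
          (Set.Ioo (-(((N + 1 : ℕ) + 1) * ε)) (((N + 1 : ℕ) + 1) * ε) ×ˢ Set.univ) := fun a =>
        (contDiff_id.mul contDiff_const).contMDiff.comp_contMDiffOn contMDiffOn_fst
      -- The group law splits time s into s (N+1)/(N+2) and s/(N+2): the first part is covered by
      -- the induction hypothesis, the second by the small-time statement.
      have h1 := ih.comp ((hscale ((N + 1) / (N + 2))).prodMk contMDiffOn_snd) (fun q hq => by
        refine ⟨?_, trivial⟩
        obtain ⟨⟨h1, h2⟩, -⟩ := hq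
        push_cast at h1 h2
        have h3 : (N + 1 : ℝ) * ε = ((N + 1 + 1) * ε) * ((N + 1) / (N + 2)) := by
          field_simp; ring
        have hpos : (0 : ℝ) < (N + 1) / (N + 2) := by positivity
        change -((N + 1 : ℝ) * ε) < q.1 * _ ∧ q.1 * _ < (N + 1 : ℝ) * ε
        rw [h3, ← neg_mul]
        exact ⟨mul_lt_mul_of_pos_right h1 hpos, mul_lt_mul_of_pos_right h2 hpos⟩)
      have h2 := hsmall.comp ((hscale (1 / (N + 2))).prodMk h1) (fun q hq => by
        refine ⟨?_, trivial⟩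
        obtain ⟨⟨h1, h2⟩, -⟩ := hq
        push_cast at h1 h2
        have h3 : ε = ((N + 1 + 1) * ε) * (1 / (N + 2)) := by field_simp; ring
        have hpos : (0 : ℝ) < 1 / (N + 2) := by positivity
        change -ε < q.1 * _ ∧ q.1 * _ < ε
        constructor
        · calc -ε = -((N + 1 + 1) * ε) * (1 / (N + 2)) := by rw [neg_mul, ← h3]
            _ < _ := mul_lt_mul_of_pos_right h1 hpos
        · calc _ < ((N + 1 + 1) * ε) * (1 / (N + 2)) := mul_lt_mul_of_pos_right h2 hpos
            _ = ε := h3.symm)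
      refine h2.congr fun q _ => ?_
      simp only [Function.comp]
      rw [← hadd]
      congr 1
      field_simp
      ring
  rintro ⟨s, x⟩
  obtain ⟨N, hN⟩ := exists_nat_gt (|s| / ε)
  rw [div_lt_iff₀ hε] at hN
  refine (hall N).contMDiffAt (prod_mem_nhds (isOpen_Ioo.mem_nhds ?_) Filter.univ_mem)
  rw [Set.mem_Ioo, ← abs_lt]
  linarith

end Flow

/-! ### Two-forms on a vector space: Cartan's formula and pullback under a flow. -/

section AlternatingForms

variable {E : Type*} [NormedAddCommGroup E] [NormedSpace ℝ E]

/-- Currying of alternating two-forms. -/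
def curryForm (A : E [⋀^Fin 2]→L[ℝ] ℝ) : E →L[ℝ] E →L[ℝ] ℝ :=
  ((ContinuousLinearMap.compL ℝ E (E [⋀^Fin 0]→L[ℝ] ℝ) ℝ
    (ContinuousAlternatingMap.apply ℝ E ℝ ![])) ∘L
      (ContinuousAlternatingMap.curryLeftLI (𝕜 := ℝ) (E := E) (F := ℝ)
        (n := 0)).toContinuousLinearMap) ∘L A.curryLeft

lemma curryForm_apply (A : E [⋀^Fin 2]→L[ℝ] ℝ) (u v : E) : curryForm A u v = A ![u, v] := rfl

lemma isBoundedLinearMap_curryForm : IsBoundedLinearMap ℝ (curryForm (E := E)) where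
  map_add a b := by ext u v; simp [curryForm_apply]
  map_smul a b := by ext u v; simp [curryForm_apply]
  bound := ⟨1, one_pos, fun A => by
    refine ContinuousLinearMap.opNorm_le_bound₂ _ (by positivity) fun u v => ?_
    have := A.le_opNorm ![u, v]
    simpa [Fin.prod_univ_two, mul_assoc, curryForm_apply] using this⟩

lemma contDiff_curryForm {n : ℕ∞ω} : ContDiff ℝ n (curryForm (E := E)) :=
  isBoundedLinearMap_curryForm.contDiff

/-- Currying turns evaluation of a varying form on varying vectors into two applications of
continuous linear maps, to which the product rule applies. -/
lemma exists_hasFDerivAt_curryForm {W : E → E [⋀^Fin 2]→L[ℝ] ℝ} {z : E}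
    (hW : DifferentiableAt ℝ W z) : ∃ D : E →L[ℝ] E →L[ℝ] E →L[ℝ] ℝ,
      HasFDerivAt (fun y => curryForm (W y)) D z ∧
        ∀ u a b, D u a b = fderiv ℝ W z u ![a, b] := by
  have hd : DifferentiableAt ℝ (fun y => curryForm (W y)) z :=
    (contDiff_curryForm.differentiable one_ne_zero (W z)).comp z hW
  refine ⟨_, hd.hasFDerivAt, fun u a b => ?_⟩
  have h1 := ((hd.hasFDerivAt.clm_apply (hasFDerivAt_const a z)).clm_apply
    (hasFDerivAt_const b z)).fderiv
  have h2 := fderiv_continuousAlternatingMap_apply_const_apply hW ![a, b] u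
  have h3 : (fun y => curryForm (W y) a b) = fun y => W y ![a, b] := rfl
  rw [← h2, ← h3, h1]
  simp

lemma form_swap (A : E [⋀^Fin 2]→L[ℝ] ℝ) (u v : E) : A ![u, v] = -A ![v, u] := by
  have h : (![v, u] ∘ Equiv.swap (0 : Fin 2) 1 : Fin 2 → E) = ![u, v] := by
    ext i; fin_cases i <;> simp
  rw [← h]
  exact A.map_swap ![v, u] (by decide)

lemma form_self (A : E [⋀^Fin 2]→L[ℝ] ℝ) (u : E) : A ![u, u] = 0 := by
  have := form_swap A u u
  linarith

/-- Closedness of a two-form, written out. -/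
lemma extDeriv_two_apply {W : E → E [⋀^Fin 2]→L[ℝ] ℝ} {z : E} (u v w : E) :
    extDeriv W z ![u, v, w] = fderiv ℝ W z u ![v, w] - fderiv ℝ W z v ![u, w] +
      fderiv ℝ W z w ![u, v] := by
  have h0 : Fin.removeNth (0 : Fin 3) ![u, v, w] = ![v, w] := by
    ext i; fin_cases i <;> rfl
  have h1 : Fin.removeNth (1 : Fin 3) ![u, v, w] = ![u, w] := by
    ext i; fin_cases i <;> rfl
  have h2 : Fin.removeNth (2 : Fin 3) ![u, v, w] = ![u, v] := by
    ext i; fin_cases i <;> rfl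
  rw [extDeriv, ContinuousAlternatingMap.alternatizeUncurryFin_apply, Fin.sum_univ_three, h0, h1,
    h2]
  simp
  ring

/-- Cartan's formula for the Lie derivative of a closed two-form along a Hamiltonian vector
field. -/
lemma lieDeriv_eq_zero {W : E → E [⋀^Fin 2]→L[ℝ] ℝ} {Y : E → E} {k : E → ℝ} {z : E}
    (hW : DifferentiableAt ℝ W z) (hdW : extDeriv W z = 0) (hY : DifferentiableAt ℝ Y z)
    (hk : ContDiffAt ℝ 2 k z)
    (hYk : ∀ᶠ y in 𝓝 z, ∀ v, W y ![Y y, v] = -fderiv ℝ k y v) (u v : E) :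
    fderiv ℝ W z (Y z) ![u, v] + W z ![fderiv ℝ Y z u, v] + W z ![u, fderiv ℝ Y z v] = 0 := by
  have hsymm : IsSymmSndFDerivAt ℝ k z := hk.isSymmSndFDerivAt (by simp)
  have hk' : DifferentiableAt ℝ (fderiv ℝ k) z :=
    (hk.fderiv_right (m := 1) (by norm_num)).differentiableAt one_ne_zero
  obtain ⟨D, hC, hD⟩ := exists_hasFDerivAt_curryForm hW
  have h1 := hC.clm_apply hY.hasFDerivAt
  have h2 : (fun y => curryForm (W y) (Y y)) =ᶠ[𝓝 z] fun y => -fderiv ℝ k y := by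
    filter_upwards [hYk] with y hy
    ext v
    exact hy v
  have h3 := (h1.congr_of_eventuallyEq h2.symm).unique hk'.hasFDerivAt.neg
  -- This is the derivative of the identity W(Y, ·) = -dk. Antisymmetrizing in a and b removes the
  -- Hessian of k, and closedness of W trades the remaining derivatives of W for the one along Y.
  have key : ∀ a b : E, W z ![fderiv ℝ Y z a, b] + fderiv ℝ W z a ![Y z, b] =
      -fderiv ℝ (fderiv ℝ k) z a b := fun a b => by
    rw [← hD]
    exact DFunLike.congr_fun (DFunLike.congr_fun h3 a) b
  have h4 := key u v
  have h5 := key v u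
  have h6 := hsymm u v
  have h7 : extDeriv W z ![Y z, u, v] = 0 := by rw [hdW]; rfl
  rw [extDeriv_two_apply] at h7
  have h8 := form_swap (W z) u (fderiv ℝ Y z v)
  have h9 := form_swap (fderiv ℝ W z v) u (Y z)
  linarith

/-- The pullback of a closed two-form under the flow of a Hamiltonian vector field has zero
derivative at time zero. -/
lemma hasDerivAt_flow_form {W : E → E [⋀^Fin 2]→L[ℝ] ℝ} {Y : E → E} {k : E → ℝ} {z : E}
    (hW : DifferentiableAt ℝ W z) (hdW : extDeriv W z = 0) (hY : DifferentiableAt ℝ Y z)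
    (hk : ContDiffAt ℝ 2 k z)
    (hYk : ∀ᶠ y in 𝓝 z, ∀ v, W y ![Y y, v] = -fderiv ℝ k y v)
    {F : ℝ × E → E} (hF : ContDiffAt ℝ 2 F (0, z)) (hF0 : ∀ᶠ y in 𝓝 z, F (0, y) = y)
    (hFY : ∀ᶠ y in 𝓝 z, fderiv ℝ F (0, y) (1, 0) = Y y) (u v : E) :
    HasDerivAt (fun s : ℝ => W (F (s, z)) ![fderiv ℝ F (s, z) (0, u), fderiv ℝ F (s, z) (0, v)])
      0 0 := by
  have hF1 : DifferentiableAt ℝ F (0, z) := hF.differentiableAt two_ne_zero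
  have hF' : DifferentiableAt ℝ (fderiv ℝ F) (0, z) :=
    (hF.fderiv_right (m := 1) (by norm_num)).differentiableAt one_ne_zero
  have hsymm : IsSymmSndFDerivAt ℝ F (0, z) := hF.isSymmSndFDerivAt (by simp)
  have hline : HasDerivAt (fun s : ℝ => (s, z)) ((1 : ℝ), (0 : E)) 0 :=
    (hasDerivAt_id 0).prodMk (hasDerivAt_const 0 z)
  have hz : F (0, z) = z := hF0.self_of_nhds
  have hcurve : HasDerivAt (fun s : ℝ => F (s, z)) (Y z) 0 := by
    have := hF1.hasFDerivAt.comp_hasDerivAt (0 : ℝ) hline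
    rwa [hFY.self_of_nhds] at this
  -- the mixed second derivative of the flow
  have hmixed : ∀ w : E, HasDerivAt (fun s : ℝ => fderiv ℝ F (s, z) (0, w)) (fderiv ℝ Y z w) 0 := by
    intro w
    have h0 : HasDerivAt (fun s : ℝ => fderiv ℝ F (s, z)) (fderiv ℝ (fderiv ℝ F) (0, z) (1, 0)) 0 :=
      hF'.hasFDerivAt.comp_hasDerivAt (0 : ℝ) hline
    have h1 := h0.clm_apply (hasDerivAt_const (0 : ℝ) ((0 : ℝ), w))
    have h2 : HasFDerivAt (fun y : E => fderiv ℝ F (0, y) (1, 0))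
        ((fderiv ℝ (fderiv ℝ F) (0, z) ∘L .inr ℝ ℝ E).flip (1, 0)) z := by
      have h0 : HasFDerivAt (fun y : E => fderiv ℝ F (0, y))
          (fderiv ℝ (fderiv ℝ F) (0, z) ∘L .inr ℝ ℝ E) z :=
        hF'.hasFDerivAt.comp z (hasFDerivAt_prodMk_right (0 : ℝ) z)
      have := h0.clm_apply (hasFDerivAt_const ((1 : ℝ), (0 : E)) z)
      simpa using this
    have h3 := (h2.congr_of_eventuallyEq (f₁ := Y)
      (hFY.mono fun y hy => hy.symm)).unique hY.hasFDerivAt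
    have h4 := DFunLike.congr_fun h3 w
    have h5 := hsymm (1, 0) (0, w)
    have h6 : fderiv ℝ (fderiv ℝ F) (0, z) (0, w) (1, 0) = fderiv ℝ Y z w := h4
    rw [← h6, ← h5]
    simpa using h1
  have hid : ∀ w : E, fderiv ℝ F (0, z) (0, w) = w := by
    intro w
    have h1 : HasFDerivAt (fun y : E => F (0, y)) (fderiv ℝ F (0, z) ∘L .inr ℝ ℝ E) z :=
      hF1.hasFDerivAt.comp z (hasFDerivAt_prodMk_right (0 : ℝ) z)
    have h2 := (h1.congr_of_eventuallyEq (f₁ := fun y => y)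
      (hF0.mono fun y hy => hy.symm)).unique (hasFDerivAt_id z)
    exact DFunLike.congr_fun h2 w
  obtain ⟨D, hC, hD⟩ := exists_hasFDerivAt_curryForm hW
  have hW' : HasDerivAt (fun s : ℝ => curryForm (W (F (s, z)))) (D (Y z)) 0 := by
    have hWz : HasFDerivAt (fun y => curryForm (W y)) D (F (0, z)) := by rw [hz]; exact hC
    exact HasFDerivAt.comp_hasDerivAt (E := E →L[ℝ] E →L[ℝ] ℝ) (f := fun s : ℝ => F (s, z)) (0 : ℝ) hWz hcurve
  -- The product rule produces exactly the three terms of the Lie derivative.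
  have hfinal := (hW'.clm_apply (hmixed u)).clm_apply (hmixed v)
  have hlie := lieDeriv_eq_zero hW hdW hY hk hYk u v
  have hval : (D (Y z) (fderiv ℝ F (0, z) (0, u)) +
      curryForm (W (F (0, z))) (fderiv ℝ Y z u)) (fderiv ℝ F (0, z) (0, v)) +
      curryForm (W (F (0, z))) (fderiv ℝ F (0, z) (0, u)) (fderiv ℝ Y z v) = 0 := by
    rw [hid, hid, hz, add_apply, hD]
    exact hlie
  rw [hval] at hfinal
  exact hfinal

end AlternatingForms

/-! ### Hamiltonian vector fields and their smoothness. -/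

section HamiltonianVectorField

universe u

variable {E : Type u} [NormedAddCommGroup E] [NormedSpace ℝ E]
  {M : Type*} [TopologicalSpace M] [ChartedSpace E M]

section TangentMap

variable {F : Type*} [NormedAddCommGroup F] [NormedSpace ℝ F]
  {N : Type*} [TopologicalSpace N] [ChartedSpace F N]
  {G : Type*} [NormedAddCommGroup G] [NormedSpace ℝ G]
  {P : Type*} [TopologicalSpace P] [ChartedSpace G P]

variable (E F) in
/-- The derivative of a map between manifolds, as a linear map between the model spaces. -/
def tderiv (f : M → N) (x : M) : E →L[ℝ] F := mfderiv 𝓘(ℝ, E) 𝓘(ℝ, F) f x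

lemma tderiv_comp {g : N → P} {f : M → N} {x : M} (hg : MDifferentiableAt 𝓘(ℝ, F) 𝓘(ℝ, G) g (f x))
    (hf : MDifferentiableAt 𝓘(ℝ, E) 𝓘(ℝ, F) f x) :
    tderiv E G (fun x => g (f x)) x = (tderiv F G g (f x)).comp (tderiv E F f x) :=
  mfderiv_comp x hg hf

lemma tderiv_comp_apply {g : N → P} {f : M → N} {x : M}
    (hg : MDifferentiableAt 𝓘(ℝ, F) 𝓘(ℝ, G) g (f x))
    (hf : MDifferentiableAt 𝓘(ℝ, E) 𝓘(ℝ, F) f x) (u : E) :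
    tderiv E G (fun x => g (f x)) x u = tderiv F G g (f x) (tderiv E F f x u) := by
  rw [tderiv_comp hg hf]; rfl

lemma tderiv_eq_fderiv (f : E → F) (x : E) : tderiv E F f x = fderiv ℝ f x := mfderiv_eq_fderiv

lemma tderiv_id (x : M) : tderiv E E (fun x : M => x) x = ContinuousLinearMap.id ℝ E :=
  mfderiv_id

lemma tderiv_congr {f g : M → N} {x : M} (h : f =ᶠ[𝓝 x] g) : tderiv E F f x = tderiv E F g x :=
  h.mfderiv_eq

end TangentMap

/-- The bilinear form on a tangent space underlying a symplectic form. -/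
def bilinAt (Ω : SymplecticForm E M) (x : M) : E →L[ℝ] E →L[ℝ] ℝ :=
  curryForm (E := E) (Ω.form x)

lemma bilinAt_self (Ω : SymplecticForm E M) (x : M) (u : E) : bilinAt Ω x u u = 0 :=
  form_self (E := E) (Ω.form x) u

lemma bilinAt_nondegenerate (Ω : SymplecticForm E M) (x : M) {u : E}
    (h : ∀ v, bilinAt Ω x u v = 0) : u = 0 :=
  Ω.nondegenerate x u h

lemma isSymplectic_iff {Ω : SymplecticForm E M} {f : M → M} : IsSymplectic Ω f ↔
    ∀ x u v, bilinAt Ω (f x) (tderiv E E f x u) (tderiv E E f x v) = bilinAt Ω x u v :=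
  Iff.rfl

lemma finrank_dual_eq [FiniteDimensional ℝ E] :
    Module.finrank ℝ E = Module.finrank ℝ (E →L[ℝ] ℝ) := by
  rw [← (LinearMap.toContinuousLinearMap (𝕜 := ℝ) (E := E) (F' := ℝ)).finrank_eq,
    Subspace.dual_finrank_eq]

section Charts

variable [IsManifold 𝓘(ℝ, E) ∞ M]

lemma tderiv_symm_tderiv_chart {x₀ q : M} (hq : q ∈ (chartAt E x₀).source) (u : E) :
    tderiv E E (chartAt E x₀).symm (chartAt E x₀ q) (tderiv E E (chartAt E x₀) q u) = u :=
  DFunLike.congr_fun ((mdifferentiable_chart (I := 𝓘(ℝ, E)) x₀).symm_comp_deriv hq) u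

lemma tderiv_symm_tderiv_chart' {x₀ : M} {y : E} (hy : y ∈ (chartAt E x₀).target) (u : E) :
    tderiv E E (chartAt E x₀).symm y
      (tderiv E E (chartAt E x₀) ((chartAt E x₀).symm y) u) = u := by
  have h := tderiv_symm_tderiv_chart ((chartAt E x₀).map_target hy) u
  rwa [(chartAt E x₀).right_inv hy] at h

lemma tderiv_chart_tderiv_symm {x₀ : M} {y : E} (hy : y ∈ (chartAt E x₀).target) (u : E) :
    tderiv E E (chartAt E x₀) ((chartAt E x₀).symm y)
      (tderiv E E (chartAt E x₀).symm y u) = u :=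
  DFunLike.congr_fun ((mdifferentiable_chart (I := 𝓘(ℝ, E)) x₀).comp_symm_deriv hy) u

omit [IsManifold 𝓘(ℝ, E) ∞ M] in
lemma inChart_apply (Ω : SymplecticForm E M) (x₀ : M) (y u v : E) :
    inChart Ω.form x₀ y ![u, v] = bilinAt Ω ((chartAt E x₀).symm y)
      (tderiv E E (chartAt E x₀).symm y u) (tderiv E E (chartAt E x₀).symm y v) := by
  change Ω.form ((chartAt E x₀).symm y) _ = Ω.form ((chartAt E x₀).symm y) _
  congr 1
  ext i
  fin_cases i <;> rfl

lemma bilinAt_eq_inChart (Ω : SymplecticForm E M) {x₀ q : M} (hq : q ∈ (chartAt E x₀).source)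
    (u v : E) : bilinAt Ω q u v = inChart Ω.form x₀ (chartAt E x₀ q)
      ![tderiv E E (chartAt E x₀) q u, tderiv E E (chartAt E x₀) q v] := by
  rw [inChart_apply, tderiv_symm_tderiv_chart hq, tderiv_symm_tderiv_chart hq,
    (chartAt E x₀).left_inv hq]

lemma fderiv_comp_chart_symm {h : M → ℝ} {x₀ : M} {y : E} (hy : y ∈ (chartAt E x₀).target)
    (hh : MDifferentiableAt 𝓘(ℝ, E) 𝓘(ℝ, ℝ) h ((chartAt E x₀).symm y)) (v : E) :
    fderiv ℝ (h ∘ (chartAt E x₀).symm) y v =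
      tderiv E ℝ h ((chartAt E x₀).symm y) (tderiv E E (chartAt E x₀).symm y v) := by
  rw [← tderiv_eq_fderiv, ← tderiv_comp_apply hh
    (mdifferentiableAt_atlas_symm (chart_mem_atlas E x₀) hy)]
  rfl

lemma contDiffOn_comp_chart_symm {h : M → ℝ} (hh : ContMDiff 𝓘(ℝ, E) 𝓘(ℝ, ℝ) ∞ h) (x₀ : M) :
    ContDiffOn ℝ ∞ (h ∘ (chartAt E x₀).symm) (chartAt E x₀).target := by
  rw [← contMDiffOn_iff_contDiffOn]
  exact hh.comp_contMDiffOn (contMDiffOn_chart_symm (I := 𝓘(ℝ, E)) (x := x₀))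

end Charts

variable [FiniteDimensional ℝ E]

/-- A nondegenerate bilinear form induces an isomorphism with the dual space. -/
lemma isInvertible_of_nondegenerate {B : E →L[ℝ] E →L[ℝ] ℝ}
    (hB : ∀ u, (∀ v, B u v = 0) → u = 0) : B.IsInvertible := by
  have hinj : Function.Injective (B : E →ₗ[ℝ] E →L[ℝ] ℝ) := by
    rw [← LinearMap.ker_eq_bot, LinearMap.ker_eq_bot']
    intro u hu
    exact hB u fun v => DFunLike.congr_fun hu v
  exact ⟨(LinearMap.linearEquivOfInjective (B : E →ₗ[ℝ] E →L[ℝ] ℝ) hinj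
    finrank_dual_eq).toContinuousLinearEquiv, by ext; rfl⟩

/-- The Hamiltonian vector field of a function. -/
def hamVec (Ω : SymplecticForm E M) (h : M → ℝ) (x : M) : E :=
  -(bilinAt Ω x).inverse (tderiv E ℝ h x)

/-- The Hamiltonian vector field of a function, as a section of the tangent bundle. -/
def hamField (Ω : SymplecticForm E M) (h : M → ℝ) (x : M) : TangentSpace 𝓘(ℝ, E) x :=
  hamVec (E := E) Ω h x

lemma bilinAt_hamVec (Ω : SymplecticForm E M) (h : M → ℝ) (x : M) (v : E) :
    bilinAt Ω x (hamVec Ω h x) v = -tderiv E ℝ h x v := by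
  have h1 := DFunLike.congr_fun ((isInvertible_of_nondegenerate
    fun _ => bilinAt_nondegenerate Ω x).self_comp_inverse) (tderiv E ℝ h x)
  have h2 : bilinAt Ω x ((bilinAt Ω x).inverse (tderiv E ℝ h x)) v = tderiv E ℝ h x v :=
    DFunLike.congr_fun h1 v
  rw [hamVec, map_neg, ← h2]
  rfl

lemma isHamiltonianVectorField_hamField (Ω : SymplecticForm E M) (h : M → ℝ) :
    IsHamiltonianVectorField Ω h (hamField Ω h) := fun x v => bilinAt_hamVec Ω h x v

lemma eq_hamVec {Ω : SymplecticForm E M} {h : M → ℝ} {x : M} {u : E}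
    (hu : ∀ v, bilinAt Ω x u v = -tderiv E ℝ h x v) : u = hamVec Ω h x := by
  refine sub_eq_zero.1 (bilinAt_nondegenerate Ω x fun v => ?_)
  rw [map_sub, sub_apply, hu, bilinAt_hamVec, sub_self]

omit [FiniteDimensional ℝ E] in
lemma hamVec_of_tderiv_eq_zero {Ω : SymplecticForm E M} {h : M → ℝ} {x : M}
    (hh : tderiv E ℝ h x = 0) : hamVec Ω h x = 0 := by
  rw [hamVec, hh, map_zero, neg_zero]

variable [IsManifold 𝓘(ℝ, E) ∞ M]

lemma inChart_coordField (Ω : SymplecticForm E M) {h : M → ℝ}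
    (hh : ContMDiff 𝓘(ℝ, E) 𝓘(ℝ, ℝ) ∞ h) {x₀ : M} {y : E} (hy : y ∈ (chartAt E x₀).target)
    (v : E) : inChart Ω.form x₀ y ![coordField (hamField Ω h) x₀ y, v] =
      -fderiv ℝ (h ∘ (chartAt E x₀).symm) y v := by
  have h1 : tderiv E E (chartAt E x₀).symm y (coordField (hamField Ω h) x₀ y) =
      hamVec Ω h ((chartAt E x₀).symm y) := tderiv_symm_tderiv_chart' hy _
  rw [inChart_apply, fderiv_comp_chart_symm hy (hh.mdifferentiable (by simp) _),
    ← bilinAt_hamVec, h1]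

/-- In the chart the field is minus the inverse of the curried form applied to the differential of
the function, and inversion is smooth at invertible operators. -/
lemma contDiffOn_coordField_hamField (Ω : SymplecticForm E M) {h : M → ℝ}
    (hh : ContMDiff 𝓘(ℝ, E) 𝓘(ℝ, ℝ) ∞ h) (x₀ : M) :
    ContDiffOn ℝ ∞ (coordField (hamField Ω h) x₀) (chartAt E x₀).target := by
  set χ := chartAt E x₀
  have hinv : ∀ y ∈ χ.target, (curryForm (inChart Ω.form x₀ y)).IsInvertible := fun y hy => by
    refine isInvertible_of_nondegenerate fun u hu => ?_
    have h1 : tderiv E E χ.symm y u = 0 := by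
      refine bilinAt_nondegenerate Ω (χ.symm y) fun v => ?_
      have h2 := hu (tderiv E E χ (χ.symm y) v)
      rw [curryForm_apply, inChart_apply] at h2
      rwa [tderiv_symm_tderiv_chart' hy] at h2
    have h4 := tderiv_chart_tderiv_symm hy u
    rw [h1, map_zero] at h4
    exact h4.symm
  have heq : ∀ y ∈ χ.target, coordField (hamField Ω h) x₀ y =
      -(curryForm (inChart Ω.form x₀ y)).inverse (fderiv ℝ (h ∘ χ.symm) y) := fun y hy => by
    have h1 : curryForm (inChart Ω.form x₀ y) (coordField (hamField Ω h) x₀ y) =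
        -fderiv ℝ (h ∘ χ.symm) y := by
      ext v
      exact inChart_coordField Ω hh hy v
    have h2 := DFunLike.congr_fun ((hinv y hy).inverse_comp_self)
      (coordField (hamField Ω h) x₀ y)
    change (curryForm (inChart Ω.form x₀ y)).inverse (curryForm (inChart Ω.form x₀ y) _) = _ at h2
    rw [h1, map_neg] at h2
    exact h2.symm
  refine ContDiffOn.congr (fun y hy => ContDiffAt.contDiffWithinAt ?_) heq
  have hmem := χ.open_target.mem_nhds hy
  have hB : ContDiffAt ℝ ∞ (fun y => curryForm (inChart Ω.form x₀ y)) y :=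
    contDiff_curryForm.contDiffAt.comp y ((Ω.smooth x₀).contDiffAt hmem)
  have hBi : ContDiffAt ℝ ∞ (fun y => (curryForm (inChart Ω.form x₀ y)).inverse) y :=
    ContDiffAt.comp (F := E →L[ℝ] E →L[ℝ] ℝ) (g := ContinuousLinearMap.inverse) y
      ((hinv y hy).contDiffAt_map_inverse) hB
  have hd : ContDiffAt ℝ ∞ (fderiv ℝ (h ∘ χ.symm)) y :=
    ((contDiffOn_comp_chart_symm hh x₀).contDiffAt hmem).fderiv_right (by simp)
  exact (hBi.clm_apply hd).neg

lemma contMDiff_hamField (Ω : SymplecticForm E M) {h : M → ℝ}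
    (hh : ContMDiff 𝓘(ℝ, E) 𝓘(ℝ, ℝ) ∞ h) :
    ContMDiff 𝓘(ℝ, E) 𝓘(ℝ, E).tangent ∞
      (fun x => (⟨x, hamField Ω h x⟩ : TangentBundle 𝓘(ℝ, E) M)) := by
  intro x₀
  rw [Bundle.contMDiffAt_section]
  have hsrc := chart_source_mem_nhds E x₀
  have h1 : ContMDiffAt 𝓘(ℝ, E) 𝓘(ℝ, E) ∞
      (coordField (hamField Ω h) x₀ ∘ chartAt E x₀) x₀ :=
    (((contDiffOn_coordField_hamField Ω hh x₀).contDiffAt ((chartAt E x₀).open_target.mem_nhds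
      (mem_chart_target E x₀))).contMDiffAt).comp x₀
      ((contMDiffOn_chart (I := 𝓘(ℝ, E)) (x := x₀)).contMDiffAt hsrc)
  refine h1.congr_of_eventuallyEq ?_
  filter_upwards [hsrc] with x hx
  simp only [Function.comp, coordField]
  rw [(chartAt E x₀).left_inv hx, mfderiv_chartAt_eq_tangentCoordChange hx]
  rfl

end HamiltonianVectorField

/-! ### Hamiltonian flows preserve their Hamiltonian and the symplectic form. -/

section HamiltonianFlow

universe u

variable {E : Type u} [NormedAddCommGroup E] [NormedSpace ℝ E] [FiniteDimensional ℝ E]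
  {M : Type*} [TopologicalSpace M] [ChartedSpace E M] [IsManifold 𝓘(ℝ, E) ∞ M]
  [T2Space M] [CompactSpace M] {Ω : SymplecticForm E M} {h : M → ℝ}

/-- The flow of an autonomous Hamiltonian on a closed symplectic manifold. -/
def hamFlow (Ω : SymplecticForm E M) (hh : ContMDiff 𝓘(ℝ, E) 𝓘(ℝ, ℝ) ∞ h) : ℝ → M → M :=
  (exists_flow (contMDiff_hamField Ω hh)).choose

lemma contMDiff_hamFlow (hh : ContMDiff 𝓘(ℝ, E) 𝓘(ℝ, ℝ) ∞ h) :
    ContMDiff (𝓘(ℝ, ℝ).prod 𝓘(ℝ, E)) 𝓘(ℝ, E) ∞ (fun q : ℝ × M => hamFlow Ω hh q.1 q.2) :=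
  (exists_flow (contMDiff_hamField Ω hh)).choose_spec.1

lemma hamFlow_zero (hh : ContMDiff 𝓘(ℝ, E) 𝓘(ℝ, ℝ) ∞ h) (x : M) : hamFlow Ω hh 0 x = x :=
  (exists_flow (contMDiff_hamField Ω hh)).choose_spec.2.1 x

lemma isMIntegralCurve_hamFlow (hh : ContMDiff 𝓘(ℝ, E) 𝓘(ℝ, ℝ) ∞ h) (x : M) :
    IsMIntegralCurve (fun s => hamFlow Ω hh s x) (hamField Ω h) :=
  (exists_flow (contMDiff_hamField Ω hh)).choose_spec.2.2.1 x

lemma hamFlow_add (hh : ContMDiff 𝓘(ℝ, E) 𝓘(ℝ, ℝ) ∞ h) (s t : ℝ) (x : M) :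
    hamFlow Ω hh (s + t) x = hamFlow Ω hh s (hamFlow Ω hh t x) :=
  (exists_flow (contMDiff_hamField Ω hh)).choose_spec.2.2.2 s t x

lemma eq_hamFlow (hh : ContMDiff 𝓘(ℝ, E) 𝓘(ℝ, ℝ) ∞ h) {c : ℝ → M}
    (hc : IsMIntegralCurve c (hamField Ω h)) (s : ℝ) : c s = hamFlow Ω hh s (c 0) :=
  congrFun (isMIntegralCurve_Ioo_eq_of_contMDiff_boundaryless (t₀ := 0)
    ((contMDiff_hamField Ω hh).of_le (by exact_mod_cast le_top)) hc
    (isMIntegralCurve_hamFlow hh (c 0)) (hamFlow_zero hh _).symm) s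

lemma contMDiff_hamFlow_time (hh : ContMDiff 𝓘(ℝ, E) 𝓘(ℝ, ℝ) ∞ h) (s : ℝ) :
    ContMDiff 𝓘(ℝ, E) 𝓘(ℝ, E) ∞ (hamFlow Ω hh s) :=
  (contMDiff_hamFlow hh).comp (contMDiff_const.prodMk contMDiff_id)

lemma mdifferentiableAt_hamFlow (hh : ContMDiff 𝓘(ℝ, E) 𝓘(ℝ, ℝ) ∞ h) (s : ℝ) (x : M) :
    MDifferentiableAt 𝓘(ℝ, E) 𝓘(ℝ, E) (hamFlow Ω hh s) x :=
  (contMDiff_hamFlow_time hh s).mdifferentiable (by simp) x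

omit [FiniteDimensional ℝ E] [IsManifold 𝓘(ℝ, E) ∞ M] [T2Space M] [CompactSpace M] in
/-- The derivative of a function along an integral curve, as a real derivative. -/
lemma hasDerivAt_comp_of_hasMFDerivAt {F : Type*} [NormedAddCommGroup F] [NormedSpace ℝ F]
    {f : M → F} {c : ℝ → M} {s : ℝ} {w : E}
    (hf : MDifferentiableAt 𝓘(ℝ, E) 𝓘(ℝ, F) f (c s))
    (hc : HasMFDerivAt 𝓘(ℝ, ℝ) 𝓘(ℝ, E) c s
      ((1 : ℝ →L[ℝ] ℝ).smulRight (w : TangentSpace 𝓘(ℝ, E) (c s)))) :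
    HasDerivAt (fun s => f (c s)) (tderiv E F f (c s) w) s := by
  have h1 : HasFDerivAt (fun s => f (c s))
      ((tderiv E F f (c s)).comp ((1 : ℝ →L[ℝ] ℝ).smulRight w)) s :=
    hasMFDerivAt_iff_hasFDerivAt.1 (hf.hasMFDerivAt.comp s hc)
  have h2 : HasDerivAt (fun s => f (c s)) (tderiv E F f (c s) ((1 : ℝ) • w)) s := h1.hasDerivAt
  rwa [one_smul] at h2

/-- The Hamiltonian is constant along its flow. -/
lemma apply_hamFlow (hh : ContMDiff 𝓘(ℝ, E) 𝓘(ℝ, ℝ) ∞ h) (s : ℝ) (x : M) :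
    h (hamFlow Ω hh s x) = h x := by
  have hd : ∀ s, HasDerivAt (fun s => h (hamFlow Ω hh s x)) 0 s := fun s => by
    have h1 := hasDerivAt_comp_of_hasMFDerivAt (c := fun s => hamFlow Ω hh s x)
      (w := hamVec Ω h (hamFlow Ω hh s x)) (hh.mdifferentiable (by simp) _)
      (isMIntegralCurve_hamFlow hh x s)
    have h2 : tderiv E ℝ h (hamFlow Ω hh s x) (hamVec Ω h (hamFlow Ω hh s x)) = 0 := by
      have := bilinAt_hamVec Ω h (hamFlow Ω hh s x) (hamVec Ω h (hamFlow Ω hh s x))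
      rw [bilinAt_self] at this
      linarith
    rw [← h2]
    exact h1
  have := is_const_of_deriv_eq_zero (fun s => (hd s).differentiableAt) (fun s => (hd s).deriv) s 0
  simpa [hamFlow_zero] using this

/-- Conjugating the flow by the chart at y reduces this to `hasDerivAt_flow_form`. Time 0 is enough,
since the flow then stays in that single chart; other times follow from the group law. -/
lemma hasDerivAt_bilinAt_hamFlow (hh : ContMDiff 𝓘(ℝ, E) 𝓘(ℝ, ℝ) ∞ h) (y : M) (u v : E) :
    HasDerivAt (fun s => bilinAt Ω (hamFlow Ω hh s y) (tderiv E E (hamFlow Ω hh s) y u)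
      (tderiv E E (hamFlow Ω hh s) y v)) 0 0 := by
  set Θ := hamFlow Ω hh with hΘ
  set χ := chartAt E y with hχ
  set z := χ y with hz
  have hzt : z ∈ χ.target := mem_chart_target E y
  have hys : y ∈ χ.source := mem_chart_source E y
  have hsymm : χ.symm z = y := χ.left_inv hys
  have hΘ0 : ∀ x, Θ 0 x = x := hamFlow_zero hh
  let F : ℝ × E → E := fun p => χ (Θ p.1 (χ.symm p.2))
  have hsmooth : ∀ p : ℝ × E, p.2 ∈ χ.target → ContMDiffAt 𝓘(ℝ, ℝ × E) 𝓘(ℝ, E) ∞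
      (fun p : ℝ × E => Θ p.1 (χ.symm p.2)) p := fun p hp => by
    have h1 : ContMDiffAt 𝓘(ℝ, ℝ × E) 𝓘(ℝ, E) ∞ (fun p : ℝ × E => χ.symm p.2) p :=
      ((contMDiffOn_chart_symm (I := 𝓘(ℝ, E)) (x := y)).contMDiffAt
        (χ.open_target.mem_nhds hp)).comp p contDiff_snd.contMDiff.contMDiffAt
    exact (contMDiff_hamFlow hh).contMDiffAt.comp p
      (contDiff_fst.contMDiff.contMDiffAt.prodMk h1)
  have hev : ∀ᶠ p in 𝓝 ((0 : ℝ), z), p.2 ∈ χ.target ∧ Θ p.1 (χ.symm p.2) ∈ χ.source := by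
    refine Filter.Eventually.and ?_ ?_
    · exact continuousAt_snd.preimage_mem_nhds (χ.open_target.mem_nhds hzt)
    · refine (hsmooth (0, z) hzt).continuousAt.preimage_mem_nhds (χ.open_source.mem_nhds ?_)
      simpa [hΘ0, hsymm] using hys
  have hF : ∀ p : ℝ × E, p.2 ∈ χ.target → Θ p.1 (χ.symm p.2) ∈ χ.source →
      ContDiffAt ℝ ∞ F p := fun p hp hp' => by
    rw [← contMDiffAt_iff_contDiffAt]
    exact ((contMDiffOn_chart (I := 𝓘(ℝ, E)) (x := y)).contMDiffAt
      (χ.open_source.mem_nhds hp')).comp p (hsmooth p hp)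
  have hnear : ∀ᶠ w in 𝓝 z, w ∈ χ.target := χ.open_target.mem_nhds hzt
  have hF0 : ∀ᶠ w in 𝓝 z, F (0, w) = w := by
    filter_upwards [hnear] with w hw
    simp [F, hΘ0, χ.right_inv hw]
  have hFY : ∀ᶠ w in 𝓝 z, fderiv ℝ F (0, w) (1, 0) = coordField (hamField Ω h) y w := by
    filter_upwards [hnear] with w hw
    have hsrc : Θ 0 (χ.symm w) ∈ χ.source := by rw [hΘ0]; exact χ.map_target hw
    have h1 := ((hF (0, w) hw hsrc).differentiableAt (by simp)).hasFDerivAt.comp_hasDerivAt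
      (0 : ℝ) ((hasDerivAt_id (0 : ℝ)).prodMk (hasDerivAt_const (0 : ℝ) w))
    have h2 : HasDerivAt (fun s => χ (Θ s (χ.symm w)))
        (tderiv E E χ (Θ 0 (χ.symm w)) (hamVec Ω h (Θ 0 (χ.symm w)))) 0 :=
      hasDerivAt_comp_of_hasMFDerivAt (c := fun s => Θ s (χ.symm w))
        (mdifferentiableAt_atlas (chart_mem_atlas E y) hsrc) (isMIntegralCurve_hamFlow hh _ 0)
    rw [hΘ0] at h2
    exact h1.unique h2
  have hmain := hasDerivAt_flow_form (u := tderiv E E χ y u) (v := tderiv E E χ y v)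
    (((Ω.smooth y).contDiffAt (χ.open_target.mem_nhds hzt)).differentiableAt (by simp))
    (Ω.closed y z hzt)
    (((contDiffOn_coordField_hamField Ω hh y).contDiffAt
      (χ.open_target.mem_nhds hzt)).differentiableAt (by simp))
    (((contDiffOn_comp_chart_symm hh y).contDiffAt (χ.open_target.mem_nhds hzt)).of_le
      (WithTop.coe_le_coe.2 (le_top : (2 : ℕ∞) ≤ ⊤)))
    (hnear.mono fun w hw v => inChart_coordField Ω hh hw v)
    ((hF (0, z) hzt (by rw [hsymm, hΘ0]; exact hys)).of_le
      (WithTop.coe_le_coe.2 (le_top : (2 : ℕ∞) ≤ ⊤))) hF0 hFY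
  refine hmain.congr_of_eventuallyEq ?_
  have hs : ∀ᶠ s in 𝓝 (0 : ℝ), Θ s y ∈ χ.source := by
    have : Filter.Tendsto (fun s : ℝ => (s, z)) (𝓝 0) (𝓝 (0, z)) :=
      (Continuous.prodMk_left z).tendsto 0
    refine (this.eventually hev).mono fun s hs => ?_
    have := hs.2
    rwa [hsymm] at this
  filter_upwards [hs] with s hs
  have hFs := hF (s, z) hzt (by rw [hsymm]; exact hs)
  have hder : ∀ a : E, tderiv E E χ (Θ s y) (tderiv E E (Θ s) y a) =
      fderiv ℝ F (s, z) (0, tderiv E E χ y a) := fun a => by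
    have hslice : HasFDerivAt (fun w => F (s, w)) (fderiv ℝ F (s, z) ∘L .inr ℝ ℝ E) z :=
      (hFs.differentiableAt (by simp)).hasFDerivAt.comp z (hasFDerivAt_prodMk_right s z)
    rw [← tderiv_comp_apply (mdifferentiableAt_atlas (chart_mem_atlas E y) hs)
      (mdifferentiableAt_hamFlow hh s y)]
    have h1 : (fun x => χ (Θ s x)) =ᶠ[𝓝 y] fun x => F (s, χ x) := by
      filter_upwards [χ.open_source.mem_nhds hys] with x hx
      simp [F, χ.left_inv hx]
    rw [tderiv_congr h1, tderiv_comp_apply (f := χ) (g := fun w => F (s, w))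
      hslice.differentiableAt.mdifferentiableAt
      (mdifferentiableAt_atlas (chart_mem_atlas E y) hys), tderiv_eq_fderiv, hslice.fderiv]
    rfl
  rw [bilinAt_eq_inChart Ω hs, hder, hder]
  simp only [F, hsymm]
  rfl

/-- Hamiltonian flows preserve the symplectic form. -/
theorem isSymplectic_hamFlow (hh : ContMDiff 𝓘(ℝ, E) 𝓘(ℝ, ℝ) ∞ h) (t : ℝ) :
    IsSymplectic Ω (hamFlow Ω hh t) := by
  rw [isSymplectic_iff]
  intro x u v
  set Θ := hamFlow Ω hh with hΘ
  let c : ℝ → ℝ := fun s => bilinAt Ω (Θ s x) (tderiv E E (Θ s) x u) (tderiv E E (Θ s) x v)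
  -- Writing Θ_s as Θ_{s - t₀} ∘ Θ_{t₀} moves the derivative at t₀ to time 0, at the point Θ_{t₀} x
  -- and with transported vectors.
  have hc : ∀ s, HasDerivAt c 0 s := fun t₀ => by
    have h1 : HasDerivAt (fun s => bilinAt Ω (Θ s (Θ t₀ x))
        (tderiv E E (Θ s) (Θ t₀ x) (tderiv E E (Θ t₀) x u))
        (tderiv E E (Θ s) (Θ t₀ x) (tderiv E E (Θ t₀) x v))) 0 (t₀ - t₀) := by
      rw [sub_self]
      exact hasDerivAt_bilinAt_hamFlow hh _ _ _
    have h2 := h1.comp_sub_const t₀ t₀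
    refine h2.congr_of_eventuallyEq (Filter.Eventually.of_forall fun s => ?_)
    have h3 : Θ s = fun x => Θ (s - t₀) (Θ t₀ x) := by
      funext x
      rw [hΘ, ← hamFlow_add, sub_add_cancel]
    have h4 : ∀ a, tderiv E E (Θ s) x a = tderiv E E (Θ (s - t₀)) (Θ t₀ x)
        (tderiv E E (Θ t₀) x a) := fun a => by
      conv_lhs => rw [h3]
      exact tderiv_comp_apply (mdifferentiableAt_hamFlow hh _ _)
        (mdifferentiableAt_hamFlow hh _ _) a
    simp only [c]
    rw [h4, h4]
    conv_lhs => rw [h3]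
  have h1 := is_const_of_deriv_eq_zero (fun s => (hc s).differentiableAt)
    (fun s => (hc s).deriv) t 0
  have h2 : Θ 0 = fun x => x := funext fun x => hamFlow_zero hh x
  simp only [c, h2, tderiv_id] at h1
  exact h1

end HamiltonianFlow

/-! ### Hamiltonian paths, their concatenation, and the group of Hamiltonian diffeomorphisms. -/

section HamiltonianGroup

universe u

variable {E : Type u} [NormedAddCommGroup E] [NormedSpace ℝ E]
  {M : Type*} [TopologicalSpace M] [ChartedSpace E M]

section Velocity

/-- The curve `c` has velocity `w` at time `s`. -/
def HasVelocityAt (c : ℝ → M) (w : E) (s : ℝ) : Prop :=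
  HasMFDerivAt 𝓘(ℝ, ℝ) 𝓘(ℝ, E) c s
    ((1 : ℝ →L[ℝ] ℝ).smulRight (w : TangentSpace 𝓘(ℝ, E) (c s)))

lemma HasVelocityAt.congr {c c' : ℝ → M} {w : E} {s : ℝ} (h : HasVelocityAt c w s)
    (hc : c' =ᶠ[𝓝 s] c) : HasVelocityAt c' w s :=
  HasMFDerivAt.congr_of_eventuallyEq (f := c) (f₁ := c')
    (f' := (1 : ℝ →L[ℝ] ℝ).smulRight (w : TangentSpace 𝓘(ℝ, E) (c s))) h hc

lemma HasVelocityAt.comp {c : ℝ → M} {w : E} {s k : ℝ} {a : ℝ → ℝ}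
    (h : HasVelocityAt c w (a s)) (ha : HasDerivAt a k s) :
    HasVelocityAt (fun s => c (a s)) (k • w) s := by
  refine HasMFDerivAt.congr_mfderiv (HasMFDerivAt.comp s h ha.hasFDerivAt.hasMFDerivAt) ?_
  refine ContinuousLinearMap.ext_ring ?_
  change ((1 : ℝ) • k) • w = (1 : ℝ) • k • w
  rw [one_smul, one_smul]

end Velocity

lemma tderiv_const_mul {h : M → ℝ} {x : M} (hh : MDifferentiableAt 𝓘(ℝ, E) 𝓘(ℝ, ℝ) h x) (k : ℝ)
    (v : E) : tderiv E ℝ (fun x => k * h x) x v = k * tderiv E ℝ h x v := by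
  have h1 : HasFDerivAt (fun y : ℝ => k * y) (k • ContinuousLinearMap.id ℝ ℝ) (h x) :=
    (hasFDerivAt_id (h x)).const_mul k
  rw [tderiv_comp_apply (g := fun y : ℝ => k * y) h1.differentiableAt.mdifferentiableAt hh,
    tderiv_eq_fderiv, h1.fderiv]
  rfl

variable [FiniteDimensional ℝ E]

lemma hamVec_const_mul (Ω : SymplecticForm E M) {h : M → ℝ} {x : M}
    (hh : MDifferentiableAt 𝓘(ℝ, E) 𝓘(ℝ, ℝ) h x) (k : ℝ) :
    hamVec Ω (fun x => k * h x) x = k • hamVec Ω h x := by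
  refine (eq_hamVec fun v => ?_).symm
  rw [map_smul, smul_apply, bilinAt_hamVec, tderiv_const_mul hh, smul_eq_mul,
    mul_neg]

/-- `f` is the endpoint of a path `θ` of maps generated by the Hamiltonian `H`, where `H` vanishes
for times outside `[1/3, 2/3]`. -/
structure IsHamiltonianPath (Ω : SymplecticForm E M) (H : ℝ → M → ℝ) (θ : ℝ → M → M) (f : M → M) :
    Prop where
  smooth : ContMDiff (𝓘(ℝ, ℝ).prod 𝓘(ℝ, E)) 𝓘(ℝ, ℝ) ∞ (fun q : ℝ × M => H q.1 q.2)
  velocity : ∀ s x, HasVelocityAt (fun s => θ s x) (hamVec Ω (H s) (θ s x)) s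
  eq_zero_left : ∀ s ≤ 1 / 3, ∀ x, H s x = 0
  eq_zero_right : ∀ s, 2 / 3 ≤ s → ∀ x, H s x = 0
  eq_left : ∀ s ≤ 1 / 3, ∀ x, θ s x = x
  eq_right : ∀ s, 2 / 3 ≤ s → ∀ x, θ s x = f x

omit [FiniteDimensional ℝ E] in
lemma contMDiff_slice {H : ℝ → M → ℝ}
    (hH : ContMDiff (𝓘(ℝ, ℝ).prod 𝓘(ℝ, E)) 𝓘(ℝ, ℝ) ∞ (fun q : ℝ × M => H q.1 q.2)) (s : ℝ) :
    ContMDiff 𝓘(ℝ, E) 𝓘(ℝ, ℝ) ∞ (H s) :=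
  hH.comp (contMDiff_const.prodMk contMDiff_id)

/-- The paths are run one after the other at triple speed: θ₂ moves only for s in [1/3, 4/9] and θ₁
only for s in [5/9, 2/3]. At most one Hamiltonian is nonzero at any time, so the sum generates the
composite without a correction term. -/
lemma IsHamiltonianPath.mul {Ω : SymplecticForm E M} {H₁ H₂ : ℝ → M → ℝ} {θ₁ θ₂ : ℝ → M → M}
    {f₁ f₂ : M → M} (h₁ : IsHamiltonianPath Ω H₁ θ₁ f₁) (h₂ : IsHamiltonianPath Ω H₂ θ₂ f₂) :
    IsHamiltonianPath Ω (fun s x => 3 * H₂ (3 * s - 2 / 3) x + 3 * H₁ (3 * s - 4 / 3) x)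
      (fun s x => θ₁ (3 * s - 4 / 3) (θ₂ (3 * s - 2 / 3) x)) (fun x => f₁ (f₂ x)) := by
  have hd : ∀ a s : ℝ, HasDerivAt (fun s : ℝ => 3 * s - a) 3 s := fun a s => by
    simpa using ((hasDerivAt_id s).const_mul 3).sub_const a
  have hsm : ∀ {H : ℝ → M → ℝ} (a : ℝ),
      ContMDiff (𝓘(ℝ, ℝ).prod 𝓘(ℝ, E)) 𝓘(ℝ, ℝ) ∞ (fun q : ℝ × M => H q.1 q.2) →
      ContMDiff (𝓘(ℝ, ℝ).prod 𝓘(ℝ, E)) 𝓘(ℝ, ℝ) ∞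
        (fun q : ℝ × M => 3 * H (3 * q.1 - a) q.2) := fun a hH => by
    have h1 : ContMDiff (𝓘(ℝ, ℝ).prod 𝓘(ℝ, E)) 𝓘(ℝ, ℝ) ∞ (fun q : ℝ × M => 3 * q.1 - a) :=
      ((contDiff_const.mul contDiff_id).sub contDiff_const).contMDiff.comp contMDiff_fst
    exact contMDiff_const.mul (hH.comp (h1.prodMk contMDiff_snd))
  refine ⟨(hsm _ h₂.smooth).add (hsm _ h₁.smooth), fun s x => ?_, fun s hs x => ?_,
    fun s hs x => ?_, fun s hs x => ?_, fun s hs x => ?_⟩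
  -- Before 5/9 the path θ₁ is still the identity; from 4/9 on θ₂ has already reached f₂, so a full
  -- neighbourhood of each s falls under one of the two formulas.
  · rcases lt_or_ge s (5 / 9) with hs | hs
    · have h0 : (fun x => 3 * H₂ (3 * s - 2 / 3) x + 3 * H₁ (3 * s - 4 / 3) x) =
          fun x => 3 * H₂ (3 * s - 2 / 3) x := funext fun x => by
        rw [h₁.eq_zero_left _ (by linarith), mul_zero, add_zero]
      rw [h0, hamVec_const_mul Ω ((contMDiff_slice h₂.smooth _).mdifferentiable (by simp) _)]
      rw [h₁.eq_left (3 * s - 4 / 3) (by linarith)]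
      refine ((h₂.velocity (3 * s - 2 / 3) x).comp (a := fun s => 3 * s - 2 / 3) (hd (2 / 3) s)).congr ?_
      filter_upwards [eventually_lt_nhds hs] with t ht
      exact h₁.eq_left _ (by linarith) _
    · have h0 : (fun x => 3 * H₂ (3 * s - 2 / 3) x + 3 * H₁ (3 * s - 4 / 3) x) =
          fun x => 3 * H₁ (3 * s - 4 / 3) x := funext fun x => by
        rw [h₂.eq_zero_right _ (by linarith), mul_zero, zero_add]
      rw [h0, hamVec_const_mul Ω ((contMDiff_slice h₁.smooth _).mdifferentiable (by simp) _)]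
      rw [h₂.eq_right (3 * s - 2 / 3) (by linarith)]
      refine ((h₁.velocity (3 * s - 4 / 3) (f₂ x)).comp
        (a := fun s => 3 * s - 4 / 3) (hd (4 / 3) s)).congr ?_
      filter_upwards [eventually_gt_nhds (show (4 / 9 : ℝ) < s by linarith)] with t ht
      rw [h₂.eq_right _ (by linarith)]
  · rw [h₂.eq_zero_left _ (by linarith), h₁.eq_zero_left _ (by linarith), mul_zero, add_zero]
  · rw [h₂.eq_zero_right _ (by linarith), h₁.eq_zero_right _ (by linarith), mul_zero, add_zero]
  · rw [h₂.eq_left _ (by linarith), h₁.eq_left _ (by linarith)]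
  · rw [h₂.eq_right _ (by linarith), h₁.eq_right _ (by linarith)]

omit [FiniteDimensional ℝ E] in
lemma tderiv_zero_fun (x : M) : tderiv E ℝ (fun _ : M => (0 : ℝ)) x = 0 := mfderiv_const

omit [FiniteDimensional ℝ E] in
lemma hasVelocityAt_const (x : M) (s : ℝ) : HasVelocityAt (fun _ => x) (0 : E) s := by
  refine HasMFDerivAt.congr_mfderiv (hasMFDerivAt_const x s) ?_
  refine ContinuousLinearMap.ext_ring ?_
  exact (smul_zero (1 : ℝ)).symm

omit [FiniteDimensional ℝ E] in
lemma isHamiltonianPath_id (Ω : SymplecticForm E M) :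
    IsHamiltonianPath Ω (fun _ _ => 0) (fun _ x => x) (fun x => x) where
  smooth := contMDiff_const
  velocity s x := by
    rw [hamVec_of_tderiv_eq_zero (tderiv_zero_fun x)]
    exact hasVelocityAt_const x s
  eq_zero_left _ _ _ := rfl
  eq_zero_right _ _ _ := rfl
  eq_left _ _ _ := rfl
  eq_right _ _ _ := rfl

/-- The end point of a Hamiltonian path is the time-one map of a one-periodic Hamiltonian. -/
lemma IsHamiltonianPath.isHamiltonianDiffeo {Ω : SymplecticForm E M} {H : ℝ → M → ℝ}
    {θ : ℝ → M → M} {f : Equiv.Perm M} (h : IsHamiltonianPath Ω H θ f) :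
    IsHamiltonianDiffeo Ω f := by
  -- Extend H periodically and let the flow on [k, k + 1) be θ at the fractional part applied after
  -- f^k; negative k is why f must be invertible. The window around t reaches 1/3 below the integer
  -- part, where the old path is at rest at its end and the new one at its start, so one smooth
  -- formula holds on the whole window.
  have hnear : ∀ t : ℝ, ∀ᶠ s in 𝓝 t, (⌊t⌋ : ℝ) - 1 / 3 < s ∧ s < ⌊t⌋ + 1 := fun t =>
    (eventually_gt_nhds (by linarith [Int.floor_le t])).and
      (eventually_lt_nhds (Int.lt_floor_add_one t))
  have hfl : ∀ t s : ℝ, (⌊t⌋ : ℝ) - 1 / 3 < s → s < ⌊t⌋ + 1 → s < ⌊t⌋ →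
      ⌊s⌋ = ⌊t⌋ - 1 := fun t s h1 h2 h3 =>
    Int.floor_eq_iff.2 ⟨by push_cast; linarith, by push_cast; linarith⟩
  have hfl' : ∀ t s : ℝ, s < ⌊t⌋ + 1 → (⌊t⌋ : ℝ) ≤ s → ⌊s⌋ = ⌊t⌋ := fun t s h2 h3 =>
    Int.floor_eq_iff.2 ⟨h3, h2⟩
  have hHn : ∀ t s : ℝ, (⌊t⌋ : ℝ) - 1 / 3 < s → s < ⌊t⌋ + 1 → ∀ x,
      H (Int.fract s) x = H (s - ⌊t⌋) x := fun t s h1 h2 x => by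
    rcases lt_or_ge s ⌊t⌋ with h3 | h3
    · rw [h.eq_zero_left (s - ⌊t⌋) (by linarith), h.eq_zero_right]
      rw [Int.fract, hfl t s h1 h2 h3]
      push_cast
      linarith
    · rw [Int.fract, hfl' t s h2 h3]
  have hθn : ∀ t s : ℝ, (⌊t⌋ : ℝ) - 1 / 3 < s → s < ⌊t⌋ + 1 → ∀ x,
      θ (Int.fract s) ((f ^ ⌊s⌋) x) = θ (s - ⌊t⌋) ((f ^ ⌊t⌋) x) := fun t s h1 h2 x => by
    rcases lt_or_ge s ⌊t⌋ with h3 | h3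
    · rw [h.eq_left (s - ⌊t⌋) (by linarith), h.eq_right, hfl t s h1 h2 h3]
      · rw [← Equiv.Perm.mul_apply, ← zpow_one_add]
        congr 2
        ring
      · rw [Int.fract, hfl t s h1 h2 h3]
        push_cast
        linarith
    · rw [Int.fract, hfl' t s h2 h3]
  refine ⟨fun t => H (Int.fract t), fun t => hamField Ω (H (Int.fract t)),
    fun t x => θ (Int.fract t) ((f ^ ⌊t⌋) x), fun q => ?_, fun t x => ?_,
    fun t => isHamiltonianVectorField_hamField Ω _, fun x => ?_, fun t x => ?_, fun x => ?_⟩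
  · have h1 : ContMDiff (𝓘(ℝ, ℝ).prod 𝓘(ℝ, E)) 𝓘(ℝ, ℝ) ∞
        (fun p : ℝ × M => H (p.1 - ⌊q.1⌋) p.2) :=
      h.smooth.comp (((contDiff_id.sub contDiff_const).contMDiff.comp contMDiff_fst).prodMk
        contMDiff_snd)
    refine (h1 q).congr_of_eventuallyEq ?_
    filter_upwards [continuousAt_fst.eventually (hnear q.1)] with p hp
    exact hHn q.1 p.1 hp.1 hp.2 p.2
  · simp only [Int.fract_add_one]
  · simp only [Int.fract_zero, Int.floor_zero, zpow_zero, Equiv.Perm.one_apply]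
    exact h.eq_left 0 (by norm_num) x
  · have h1 := (h.velocity (t - ⌊t⌋) ((f ^ ⌊t⌋) x)).comp (a := fun s => id s - (⌊t⌋ : ℝ))
      ((hasDerivAt_id t).sub_const (⌊t⌋ : ℝ))
    rw [one_smul] at h1
    refine h1.congr ?_
    filter_upwards [hnear t] with s hs
    exact hθn t s hs.1 hs.2 x
  -- At time 1 the fractional part has returned to 0 and the power of f supplies the map.
  · simp only [Int.fract_one, Int.floor_one, zpow_one]
    exact (h.eq_left 0 (by norm_num) _).symm

variable [IsManifold 𝓘(ℝ, E) ∞ M]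

/-- Smooth symplectic maps that are end points of Hamiltonian paths. -/
structure IsHamiltonianMap (Ω : SymplecticForm E M) (f : M → M) : Prop where
  smooth : ContMDiff 𝓘(ℝ, E) 𝓘(ℝ, E) ∞ f
  symplectic : IsSymplectic Ω f
  path : ∃ H θ, IsHamiltonianPath Ω H θ f

omit [FiniteDimensional ℝ E] [IsManifold 𝓘(ℝ, E) ∞ M] in
lemma IsSymplectic.comp {Ω : SymplecticForm E M} {f g : M → M}
    (hf : IsSymplectic Ω f) (hg : IsSymplectic Ω g) (hf' : MDifferentiable 𝓘(ℝ, E) 𝓘(ℝ, E) f)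
    (hg' : MDifferentiable 𝓘(ℝ, E) 𝓘(ℝ, E) g) : IsSymplectic Ω (fun x => f (g x)) := by
  rw [isSymplectic_iff] at *
  intro x u v
  rw [tderiv_comp_apply (hf' _) (hg' _), tderiv_comp_apply (hf' _) (hg' _), hf, hg]

omit [IsManifold 𝓘(ℝ, E) ∞ M] in
lemma IsHamiltonianMap.comp {Ω : SymplecticForm E M} {f g : M → M}
    (hf : IsHamiltonianMap Ω f) (hg : IsHamiltonianMap Ω g) :
    IsHamiltonianMap Ω (fun x => f (g x)) := by
  obtain ⟨H₁, θ₁, h₁⟩ := hf.path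
  obtain ⟨H₂, θ₂, h₂⟩ := hg.path
  exact ⟨hf.smooth.comp hg.smooth, hf.symplectic.comp hg.symplectic
    (hf.smooth.mdifferentiable (by simp)) (hg.smooth.mdifferentiable (by simp)),
    _, _, h₁.mul h₂⟩

/-- A group of Hamiltonian diffeomorphisms, as permutations of the manifold. -/
def hamGroup (Ω : SymplecticForm E M) : Subgroup (Equiv.Perm M) where
  -- Imposing the condition on the inverse as well makes closure under inversion immediate; flows
  -- satisfy it by reversing time.
  carrier := {g | IsHamiltonianMap Ω g ∧ IsHamiltonianMap Ω (g⁻¹ : Equiv.Perm M)}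
  mul_mem' := fun {a b} ha hb => ⟨ha.1.comp hb.1, by
    rw [mul_inv_rev]
    exact hb.2.comp ha.2⟩
  one_mem' := by
    have h : IsHamiltonianMap Ω (fun x => x) := ⟨contMDiff_id, by
      rw [isSymplectic_iff]; intro x u v; rw [tderiv_id]; rfl, _, _, isHamiltonianPath_id Ω⟩
    exact ⟨h, by rw [inv_one]; exact h⟩
  inv_mem' := fun {a} ha => ⟨ha.2, by rw [inv_inv]; exact ha.1⟩

variable [T2Space M] [CompactSpace M] {Ω : SymplecticForm E M} {h : M → ℝ}

/-- Follow the flow with a smooth clock χ that rests at 0 up to time 1/3 and at r from time 2/3. The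
chain rule gives the generating Hamiltonian χ'(s) h. -/
lemma isHamiltonianPath_hamFlow (hh : ContMDiff 𝓘(ℝ, E) 𝓘(ℝ, ℝ) ∞ h) (r : ℝ) :
    ∃ H θ, IsHamiltonianPath Ω H θ (hamFlow Ω hh r) := by
  let χ : ℝ → ℝ := fun s => r * Real.smoothTransition (3 * s - 1)
  have hχ : ContDiff ℝ ∞ χ := contDiff_const.mul (Real.smoothTransition.contDiff.comp
    ((contDiff_const.mul contDiff_id).sub contDiff_const))
  have hχ0 : ∀ s ≤ 1 / 3, χ s = 0 := fun s hs => by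
    simp [χ, Real.smoothTransition.zero_of_nonpos (show 3 * s - 1 ≤ 0 by linarith)]
  have hχ1 : ∀ s, 2 / 3 ≤ s → χ s = r := fun s hs => by
    simp [χ, Real.smoothTransition.one_of_one_le (show 1 ≤ 3 * s - 1 by linarith)]
  have hχ' : ContDiff ℝ ∞ (deriv χ) := (contDiff_infty_iff_deriv.1 hχ).2
  have hd : ∀ s, HasDerivAt χ (deriv χ s) s := fun s =>
    (hχ.differentiable (by simp) s).hasDerivAt
  -- Stated for closed half-lines so that χ' vanishes at the endpoints 1/3 and 2/3 too: the
  -- one-sided derivative determines it.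
  have hclosed : ∀ {t : Set ℝ} {k s : ℝ}, UniqueDiffOn ℝ t → s ∈ t → (∀ s ∈ t, χ s = k) →
      deriv χ s = 0 := fun {t k s} ht hs hk => by
    have h1 := (hd s).hasDerivWithinAt (s := t)
    have h2 := (hasDerivWithinAt_const s t k).congr hk (hk s hs)
    exact (ht s hs).eq_deriv _ h1 h2
  refine ⟨fun s x => deriv χ s * h x, fun s x => hamFlow Ω hh (χ s) x,
    (hχ'.contMDiff.comp contMDiff_fst).mul (hh.comp contMDiff_snd), fun s x => ?_,
    fun s hs x => ?_, fun s hs x => ?_, fun s hs x => ?_, fun s hs x => ?_⟩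
  · rw [hamVec_const_mul Ω (hh.mdifferentiable (by simp) _)]
    exact HasVelocityAt.comp (c := fun s => hamFlow Ω hh s x)
      (isMIntegralCurve_hamFlow hh x (χ s)) (hd s)
  · rw [hclosed (uniqueDiffOn_Iic _) (Set.mem_Iic.2 hs) hχ0, zero_mul]
  · rw [hclosed (uniqueDiffOn_Ici _) (Set.mem_Ici.2 hs) hχ1, zero_mul]
  · simp only [hχ0 s hs, hamFlow_zero]
  · simp only [hχ1 s hs]

/-- The time-`s` map of an autonomous Hamiltonian flow, as a permutation. -/
def hamPerm (Ω : SymplecticForm E M) (hh : ContMDiff 𝓘(ℝ, E) 𝓘(ℝ, ℝ) ∞ h) (s : ℝ) :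
    Equiv.Perm M where
  toFun := hamFlow Ω hh s
  invFun := hamFlow Ω hh (-s)
  left_inv x := by rw [← hamFlow_add, neg_add_cancel, hamFlow_zero]
  right_inv x := by rw [← hamFlow_add, add_neg_cancel, hamFlow_zero]

lemma hamPerm_mem (hh : ContMDiff 𝓘(ℝ, E) 𝓘(ℝ, ℝ) ∞ h) (s : ℝ) :
    hamPerm Ω hh s ∈ hamGroup Ω :=
  ⟨⟨contMDiff_hamFlow_time hh s, isSymplectic_hamFlow hh s, isHamiltonianPath_hamFlow hh s⟩,
    ⟨contMDiff_hamFlow_time hh (-s), isSymplectic_hamFlow hh (-s),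
      isHamiltonianPath_hamFlow hh (-s)⟩⟩

omit [T2Space M] [CompactSpace M] [IsManifold 𝓘(ℝ, E) ∞ M] in
lemma isHamiltonianDiffeo_of_mem {g : Equiv.Perm M} (hg : g ∈ hamGroup Ω) :
    IsHamiltonianDiffeo Ω g := by
  obtain ⟨H, θ, h⟩ := hg.1.path
  exact h.isHamiltonianDiffeo

end HamiltonianGroup

/-! ### Smooth families of Hamiltonian diffeomorphisms and local transitivity. -/

section HamiltonianFamily

universe u

variable {E : Type u} [NormedAddCommGroup E] [NormedSpace ℝ E]
  {M : Type*} [TopologicalSpace M] [ChartedSpace E M] [FiniteDimensional ℝ E]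
  [IsManifold 𝓘(ℝ, E) ∞ M] {Ω : SymplecticForm E M}

section Basic

variable {F : Type*} [NormedAddCommGroup F] [NormedSpace ℝ F]
  {N : Type*} [TopologicalSpace N] [ChartedSpace F N]
  {F' : Type*} [NormedAddCommGroup F'] [NormedSpace ℝ F']
  {N' : Type*} [TopologicalSpace N'] [ChartedSpace F' N']

variable (F) in
/-- A family of Hamiltonian diffeomorphisms which, together with the family of its inverses,
depends smoothly on a parameter in `S`. -/
structure IsHamFamilyOn (Ω : SymplecticForm E M) (S : Set N) (g : N → Equiv.Perm M) : Prop where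
  mem : ∀ t ∈ S, g t ∈ hamGroup Ω
  smooth : ContMDiffOn (𝓘(ℝ, F).prod 𝓘(ℝ, E)) 𝓘(ℝ, E) ∞ (fun q : N × M => g q.1 q.2)
    (S ×ˢ Set.univ)
  smooth_inv : ContMDiffOn (𝓘(ℝ, F).prod 𝓘(ℝ, E)) 𝓘(ℝ, E) ∞
    (fun q : N × M => (g q.1)⁻¹ q.2) (S ×ˢ Set.univ)

variable {S : Set N} {g h : N → Equiv.Perm M}

omit [IsManifold 𝓘(ℝ, E) ∞ M] in
lemma IsHamFamilyOn.mul (hg : IsHamFamilyOn F Ω S g) (hh : IsHamFamilyOn F Ω S h) :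
    IsHamFamilyOn F Ω S (fun t => g t * h t) where
  mem t ht := mul_mem (hg.mem t ht) (hh.mem t ht)
  smooth := hg.smooth.comp (contMDiffOn_fst.prodMk hh.smooth) fun _ hq => ⟨hq.1, trivial⟩
  smooth_inv := (hh.smooth_inv.comp (contMDiffOn_fst.prodMk hg.smooth_inv)
    fun _ hq => ⟨hq.1, trivial⟩).congr fun q _ => by
      simp only [mul_inv_rev]
      rfl

omit [IsManifold 𝓘(ℝ, E) ∞ M] in
lemma IsHamFamilyOn.inv (hg : IsHamFamilyOn F Ω S g) :
    IsHamFamilyOn F Ω S (fun t => (g t)⁻¹) where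
  mem t ht := inv_mem (hg.mem t ht)
  smooth := hg.smooth_inv
  smooth_inv := by simpa only [inv_inv] using hg.smooth

omit [IsManifold 𝓘(ℝ, E) ∞ M] in
lemma IsHamFamilyOn.comp (hg : IsHamFamilyOn F Ω S g) {τ : N' → N} {S' : Set N'}
    (hτ : ContMDiffOn 𝓘(ℝ, F') 𝓘(ℝ, F) ∞ τ S') (hS : Set.MapsTo τ S' S) :
    IsHamFamilyOn F' Ω S' (fun t => g (τ t)) := by
  have h1 : ContMDiffOn (𝓘(ℝ, F').prod 𝓘(ℝ, E)) (𝓘(ℝ, F).prod 𝓘(ℝ, E)) ∞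
      (fun q : N' × M => (τ q.1, q.2)) (S' ×ˢ Set.univ) :=
    (hτ.comp contMDiffOn_fst fun _ hq => hq.1).prodMk contMDiffOn_snd
  exact ⟨fun t ht => hg.mem _ (hS ht), hg.smooth.comp h1 fun q hq => ⟨hS hq.1, trivial⟩,
    hg.smooth_inv.comp h1 fun q hq => ⟨hS hq.1, trivial⟩⟩

omit [IsManifold 𝓘(ℝ, E) ∞ M] in
lemma IsHamFamilyOn.mono (hg : IsHamFamilyOn F Ω S g) {S' : Set N} (hS : S' ⊆ S) :
    IsHamFamilyOn F Ω S' g :=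
  hg.comp contMDiffOn_id hS

omit [IsManifold 𝓘(ℝ, E) ∞ M] in
lemma IsHamFamilyOn.congr (hg : IsHamFamilyOn F Ω S g) (hh : ∀ t ∈ S, h t = g t) :
    IsHamFamilyOn F Ω S h where
  mem t ht := by rw [hh t ht]; exact hg.mem t ht
  smooth := hg.smooth.congr fun q hq => by rw [hh q.1 hq.1]
  smooth_inv := hg.smooth_inv.congr fun q hq => by rw [hh q.1 hq.1]

-- Smoothness is local in the parameter. This serves to check a family given by one formula where
-- different descriptions are convenient on two overlapping open sets.
omit [IsManifold 𝓘(ℝ, E) ∞ M] in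
lemma IsHamFamilyOn.of_union {U V : Set N} (hU : IsOpen U) (hV : IsOpen V)
    (hgU : IsHamFamilyOn F Ω (S ∩ U) g) (hgV : IsHamFamilyOn F Ω (S ∩ V) g)
    (hS : S ⊆ U ∪ V) : IsHamFamilyOn F Ω S g := by
  have key : ∀ {f : N × M → M},
      ContMDiffOn (𝓘(ℝ, F).prod 𝓘(ℝ, E)) 𝓘(ℝ, E) ∞ f ((S ∩ U) ×ˢ Set.univ) →
      ContMDiffOn (𝓘(ℝ, F).prod 𝓘(ℝ, E)) 𝓘(ℝ, E) ∞ f ((S ∩ V) ×ˢ Set.univ) →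
      ContMDiffOn (𝓘(ℝ, F).prod 𝓘(ℝ, E)) 𝓘(ℝ, E) ∞ f (S ×ˢ Set.univ) := by
    intro f hfU hfV q hq
    have hmem : ∀ {W : Set N}, IsOpen W → q.1 ∈ W →
        (S ∩ W) ×ˢ (Set.univ : Set M) ∈ 𝓝[S ×ˢ Set.univ] q := fun {W} hW hqW => by
      have h1 : (fun p : N × M => p.1) ⁻¹' W ∈ 𝓝 q :=
        continuousAt_fst.preimage_mem_nhds (hW.mem_nhds hqW)
      filter_upwards [mem_nhdsWithin_of_mem_nhds h1, self_mem_nhdsWithin] with p hp hp'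
      exact ⟨⟨hp'.1, hp⟩, trivial⟩
    rcases hS hq.1 with h | h
    · exact (hfU q ⟨⟨hq.1, h⟩, trivial⟩).mono_of_mem_nhdsWithin (hmem hU h)
    · exact (hfV q ⟨⟨hq.1, h⟩, trivial⟩).mono_of_mem_nhdsWithin (hmem hV h)
  refine ⟨fun t ht => ?_, key hgU.smooth hgV.smooth, key hgU.smooth_inv hgV.smooth_inv⟩
  rcases hS ht with h | h
  · exact hgU.mem t ⟨ht, h⟩
  · exact hgV.mem t ⟨ht, h⟩

variable (F) in
omit [IsManifold 𝓘(ℝ, E) ∞ M] in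
lemma isHamFamilyOn_const {a : Equiv.Perm M} (ha : a ∈ hamGroup Ω) (S : Set N) :
    IsHamFamilyOn F Ω S (fun _ => a) :=
  ⟨fun _ _ => ha, ha.1.smooth.comp_contMDiffOn contMDiffOn_snd,
    ha.2.smooth.comp_contMDiffOn contMDiffOn_snd⟩

end Basic

section LocalTransitivity

omit [FiniteDimensional ℝ E] in
lemma mdifferentiableAt_chart {x₀ q : M} (hq : q ∈ (chartAt E x₀).source) :
    MDifferentiableAt 𝓘(ℝ, E) 𝓘(ℝ, E) (chartAt E x₀) q :=
  mdifferentiableAt_atlas (chart_mem_atlas E x₀) hq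

variable [T2Space M]

/-- Every covector is the differential of a smooth function vanishing at the base point. -/
lemma exists_contMDiff_tderiv_eq (q : M) (ℓ : E →L[ℝ] ℝ) :
    ∃ f : M → ℝ, ContMDiff 𝓘(ℝ, E) 𝓘(ℝ, ℝ) ∞ f ∧ f q = 0 ∧ tderiv E ℝ f q = ℓ := by
  let b : SmoothBumpFunction 𝓘(ℝ, E) q := Classical.arbitrary _
  set χ := chartAt E q with hχ
  have hq : q ∈ χ.source := mem_chart_source E q
  let a : E → ℝ := fun y => ℓ (tderiv E E χ.symm (χ q) (y - χ q))
  have ha : ContDiff ℝ ∞ a := (ℓ.comp (tderiv E E χ.symm (χ q))).contDiff.comp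
    (contDiff_id.sub contDiff_const)
  have haf : HasFDerivAt a (ℓ.comp (tderiv E E χ.symm (χ q))) (χ q) :=
    (ℓ.comp (tderiv E E χ.symm (χ q))).hasFDerivAt.comp (χ q)
      ((hasFDerivAt_id (χ q)).sub_const (χ q))
  have hsm : ContMDiffOn 𝓘(ℝ, E) 𝓘(ℝ, ℝ) ∞ (fun x => a (χ x)) χ.source :=
    ha.contMDiff.comp_contMDiffOn (contMDiffOn_chart (I := 𝓘(ℝ, E)) (x := q))
  refine ⟨fun x => b x • a (χ x), b.contMDiff_smul hsm, ?_, ?_⟩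
  · simp [a]
  · have h1 : (fun x => b x • a (χ x)) =ᶠ[𝓝 q] fun x => a (χ x) := by
      filter_upwards [b.eventuallyEq_one] with x hx
      rw [hx]
      simp
    rw [tderiv_congr h1]
    ext u
    rw [tderiv_comp_apply (g := a) haf.differentiableAt.mdifferentiableAt
      (mdifferentiableAt_chart hq), tderiv_eq_fderiv, haf.fderiv]
    exact congrArg ℓ (tderiv_symm_tderiv_chart hq u)

variable [CompactSpace M]

lemma isHamFamilyOn_hamPerm {h : M → ℝ} (hh : ContMDiff 𝓘(ℝ, E) 𝓘(ℝ, ℝ) ∞ h) :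
    IsHamFamilyOn ℝ Ω Set.univ (fun s : ℝ => hamPerm Ω hh s) where
  mem s _ := hamPerm_mem hh s
  smooth := (contMDiff_hamFlow hh).contMDiffOn
  smooth_inv := ((contMDiff_hamFlow hh).comp
    ((contDiff_neg.contMDiff.comp contMDiff_fst).prodMk contMDiff_snd)).contMDiffOn

omit [FiniteDimensional ℝ E] [IsManifold 𝓘(ℝ, E) ∞ M] [T2Space M] [CompactSpace M] in
lemma tderiv_of_hasVelocityAt {c : ℝ → M} {w : E} {s : ℝ} (h : HasVelocityAt c w s) (r : ℝ) :
    tderiv ℝ E c s r = r • w := by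
  rw [tderiv, HasMFDerivAt.mfderiv h]
  rfl

variable (Ω) in
/-- `A` is the derivative at `0` of the action on `q` of a smooth family of Hamiltonian
diffeomorphisms starting at the identity. -/
def IsInfinitesimalMotion (q : M) (A : E →L[ℝ] E) : Prop :=
  ∃ L : E → Equiv.Perm M, IsHamFamilyOn E Ω Set.univ L ∧ L 0 = 1 ∧
    tderiv E E (fun s => L s q) 0 = A

omit [T2Space M] [CompactSpace M] [FiniteDimensional ℝ E] [IsManifold 𝓘(ℝ, E) ∞ M] in
lemma contMDiff_apply_of_univ {F : Type*} [NormedAddCommGroup F] [NormedSpace ℝ F]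
    {N : Type*} [TopologicalSpace N] [ChartedSpace F N] {L : N → M → M}
    (hL : ContMDiffOn (𝓘(ℝ, F).prod 𝓘(ℝ, E)) 𝓘(ℝ, E) ∞ (fun q : N × M => L q.1 q.2)
      (Set.univ ×ˢ Set.univ)) :
    ContMDiff (𝓘(ℝ, F).prod 𝓘(ℝ, E)) 𝓘(ℝ, E) ∞ (fun q : N × M => L q.1 q.2) := by
  rwa [Set.univ_prod_univ, contMDiffOn_univ] at hL

-- Both families start at the identity, so the derivative of s ↦ L_s(K_s q) at 0 is the sum of the
-- two partial contributions.
omit [T2Space M] [CompactSpace M] [IsManifold 𝓘(ℝ, E) ∞ M] in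
lemma IsInfinitesimalMotion.add {q : M} {A B : E →L[ℝ] E} (hA : IsInfinitesimalMotion Ω q A)
    (hB : IsInfinitesimalMotion Ω q B) : IsInfinitesimalMotion Ω q (A + B) := by
  obtain ⟨L, hL, hL0, hLA⟩ := hA
  obtain ⟨K, hK, hK0, hKB⟩ := hB
  refine ⟨fun s => L s * K s, hL.mul hK, by simp only [hL0, hK0, mul_one], ?_⟩
  have hGs := contMDiff_apply_of_univ (L := fun s x => L s x) hL.smooth
  have hKs := contMDiff_apply_of_univ (L := fun s x => K s x) hK.smooth
  have hK1 : MDifferentiableAt 𝓘(ℝ, E) 𝓘(ℝ, E) (fun s => K s q) 0 :=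
    (hKs.comp (contMDiff_id.prodMk contMDiff_const)).mdifferentiable (by simp) 0
  have hG : MDifferentiableAt (𝓘(ℝ, E).prod 𝓘(ℝ, E)) 𝓘(ℝ, E) (fun p : E × M => L p.1 p.2)
      (0, q) := hGs.mdifferentiable (by simp) _
  have hKq : K 0 q = q := by rw [hK0]; rfl
  ext u
  have h1 : HasMFDerivAt 𝓘(ℝ, E) (𝓘(ℝ, E).prod 𝓘(ℝ, E)) (fun s => (s, K s q)) 0
      ((ContinuousLinearMap.id ℝ (TangentSpace 𝓘(ℝ, E) (0 : E))).prod
        (mfderiv 𝓘(ℝ, E) 𝓘(ℝ, E) (fun s => K s q) 0)) :=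
    (hasMFDerivAt_id (0 : E)).prodMk hK1.hasMFDerivAt
  have hG' : MDifferentiableAt (𝓘(ℝ, E).prod 𝓘(ℝ, E)) 𝓘(ℝ, E) (fun p : E × M => L p.1 p.2)
      (0, K 0 q) := by rw [hKq]; exact hG
  have h2 := (hG'.hasMFDerivAt.comp (0 : E) h1).mfderiv
  have h3 : tderiv E E (fun s => L s (K s q)) 0 u =
      mfderiv (𝓘(ℝ, E).prod 𝓘(ℝ, E)) 𝓘(ℝ, E) (fun p : E × M => L p.1 p.2) (0, K 0 q)
        (u, tderiv E E (fun s => K s q) 0 u) := DFunLike.congr_fun h2 u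
  have h4 : mfderiv (𝓘(ℝ, E).prod 𝓘(ℝ, E)) 𝓘(ℝ, E) (fun p : E × M => L p.1 p.2) (0, K 0 q)
        (u, tderiv E E (fun s => K s q) 0 u) =
      tderiv E E (fun s => L s (K 0 q)) 0 u +
        tderiv E E (fun x => L 0 x) (K 0 q) (tderiv E E (fun s => K s q) 0 u) :=
    mfderiv_prod_eq_add_apply hG'
  have h5 : tderiv E E (fun x => L 0 x) (K 0 q) = ContinuousLinearMap.id ℝ E := by
    rw [hL0]
    exact tderiv_id _
  change tderiv E E (fun s => L s (K s q)) 0 u = _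
  rw [h3, h4, h5, hKB, hKq, hLA]
  rfl

/-- Realize v as the Hamiltonian vector at q of a function f with differential -Ω(v, ·), and follow
the flow of f for time ℓ(s). -/
lemma isInfinitesimalMotion_smulRight (q : M) (ℓ : E →L[ℝ] ℝ) (v : E) :
    IsInfinitesimalMotion Ω q (ℓ.smulRight v) := by
  obtain ⟨f, hf, -, hfv⟩ := exists_contMDiff_tderiv_eq q (-bilinAt Ω q v)
  have hv : v = hamVec Ω f q := eq_hamVec fun w => by rw [hfv]; simp
  refine ⟨fun s => hamPerm Ω hf (ℓ s), (isHamFamilyOn_hamPerm hf).comp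
    ℓ.contDiff.contMDiff.contMDiffOn fun _ _ => trivial, ?_, ?_⟩
  · ext x
    simp only [map_zero]
    exact hamFlow_zero hf x
  · ext u
    have h1 : HasVelocityAt (fun s => hamFlow Ω hf s q) v 0 := by
      have := isMIntegralCurve_hamFlow (Ω := Ω) hf q 0
      rw [hv]
      have h2 : hamVec Ω f q = hamVec Ω f (hamFlow Ω hf 0 q) := by rw [hamFlow_zero]
      rw [h2]
      exact this
    change tderiv E E (fun s => hamFlow Ω hf (ℓ s) q) 0 u = _
    rw [tderiv_comp_apply (g := fun s => hamFlow Ω hf s q) (f := ℓ)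
      (by rw [map_zero]; exact h1.mdifferentiableAt) ℓ.differentiableAt.mdifferentiableAt,
      tderiv_eq_fderiv, map_zero, tderiv_of_hasVelocityAt h1, ℓ.fderiv]
    rfl

/-- The identity is the sum over a basis of the rank-one maps u ↦ b_i^*(u) b_i, each of which is an
infinitesimal motion. -/
lemma isInfinitesimalMotion_id (q : M) :
    IsInfinitesimalMotion Ω q (ContinuousLinearMap.id ℝ E) := by
  let b := Module.finBasis ℝ E
  have h1 : ContinuousLinearMap.id ℝ E =
      ∑ i, (LinearMap.toContinuousLinearMap (b.coord i)).smulRight (b i) := by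
    ext u
    simp [sum_apply]
  rw [h1]
  refine Finset.sum_induction _ (IsInfinitesimalMotion Ω q) (fun _ _ => .add) ?_
    fun i _ => isInfinitesimalMotion_smulRight q _ _
  have := isInfinitesimalMotion_smulRight (Ω := Ω) q 0 0
  simpa using this

/-- Points near `q` are images of `q` under a smooth family of Hamiltonian diffeomorphisms. -/
lemma exists_local_motion (Ω : SymplecticForm E M) (q : M) :
    ∃ U ∈ 𝓝 q, ∃ Λ : M → Equiv.Perm M, IsHamFamilyOn E Ω U Λ ∧ ∀ y ∈ U, Λ y q = y := by
  obtain ⟨L, hL, hL0, hLid⟩ := isInfinitesimalMotion_id (Ω := Ω) q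
  set χ := chartAt E q with hχ
  have hq : q ∈ χ.source := mem_chart_source E q
  have hLq : L 0 q = q := by rw [hL0]; rfl
  have hLs : ContMDiff 𝓘(ℝ, E) 𝓘(ℝ, E) ∞ (fun s => L s q) :=
    (contMDiff_apply_of_univ (L := fun s x => L s x) hL.smooth).comp
      (contMDiff_id.prodMk contMDiff_const)
  -- The derivative of Φ at 0 is that of the chart, hence invertible; the inverse function theorem
  -- then solves L_s q = y for s, smoothly in y.
  let Φ : E → E := fun s => χ (L s q)
  have hΦ0 : Φ 0 = χ q := by simp only [Φ, hLq]
  have hV : ∀ᶠ s in 𝓝 (0 : E), L s q ∈ χ.source :=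
    hLs.continuous.continuousAt.preimage_mem_nhds
      (χ.open_source.mem_nhds (by rw [hLq]; exact hq))
  have hΦs : ∀ s, L s q ∈ χ.source → ContDiffAt ℝ ∞ Φ s := fun s hs => by
    rw [← contMDiffAt_iff_contDiffAt]
    exact ((contMDiffOn_chart (I := 𝓘(ℝ, E)) (x := q)).contMDiffAt
      (χ.open_source.mem_nhds hs)).comp s hLs.contMDiffAt
  have hs0 : L 0 q ∈ χ.source := by rw [hLq]; exact hq
  let e : E ≃L[ℝ] E := ContinuousLinearEquiv.equivOfInverse (tderiv E E χ q)
    (tderiv E E χ.symm (χ q)) (tderiv_symm_tderiv_chart hq) fun u => by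
      have h1 := tderiv_chart_tderiv_symm (M := M) (χ.map_source hq) u
      rwa [χ.left_inv hq] at h1
  have hder : HasFDerivAt Φ (e : E →L[ℝ] E) 0 := by
    have h1 : fderiv ℝ Φ 0 = (e : E →L[ℝ] E) := by
      ext u
      rw [← tderiv_eq_fderiv, tderiv_comp_apply (g := χ) (f := fun s => L s q) (mdifferentiableAt_chart hs0)
        (hLs.mdifferentiable (by simp) 0), hLid, hLq]
      rfl
    rw [← h1]
    exact ((hΦs 0 hs0).differentiableAt (by simp)).hasFDerivAt
  let R := (hΦs 0 hs0).toOpenPartialHomeomorph Φ hder (by simp)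
  have hRΦ : ∀ s, R s = Φ s := fun s => rfl
  have h0R : (0 : E) ∈ R.source := (hΦs 0 hs0).mem_toOpenPartialHomeomorph_source hder (by simp)
  have hRsymm : R.symm (χ q) = 0 := by rw [← hΦ0, ← hRΦ, R.left_inv h0R]
  have hqR : χ q ∈ R.target := by rw [← hΦ0, ← hRΦ]; exact R.map_source h0R
  -- Smoothness of the local inverse at a point needs an invertible derivative there, so
  -- invertibility is spread from 0 to a neighbourhood.
  have hinv : ∀ᶠ s in 𝓝 (0 : E), ∃ e' : E ≃L[ℝ] E, (e' : E →L[ℝ] E) = fderiv ℝ Φ s := by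
    have h1 : ContinuousAt (fderiv ℝ Φ) 0 :=
      ((hΦs 0 hs0).fderiv_right (m := 0) (by simp)).continuousAt
    have h2 := ContinuousLinearEquiv.nhds e
    rw [← hder.fderiv] at h2
    exact h1.preimage_mem_nhds h2
  have hW : ∀ᶠ y in 𝓝 q, y ∈ χ.source ∧ χ y ∈ R.target ∧ L (R.symm (χ y)) q ∈ χ.source ∧
      ∃ e' : E ≃L[ℝ] E, (e' : E →L[ℝ] E) = fderiv ℝ Φ (R.symm (χ y)) := by
    have hc : ContinuousAt χ q := χ.continuousAt hq
    have hcR : ContinuousAt (fun y => R.symm (χ y)) q :=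
      ContinuousAt.comp (f := χ) (R.continuousAt_symm hqR) hc
    have ht : Filter.Tendsto (fun y => R.symm (χ y)) (𝓝 q) (𝓝 0) := by
      have := hcR.tendsto
      rwa [hRsymm] at this
    filter_upwards [χ.open_source.mem_nhds hq, hc.preimage_mem_nhds (R.open_target.mem_nhds hqR),
      ht.eventually hV, ht.eventually hinv] with y h1 h2 h3 h4
    exact ⟨h1, h2, h3, h4⟩
  refine ⟨_, hW, fun y => L (R.symm (χ y)), hL.comp (fun y hy => ?_) fun _ _ => trivial,
    fun y hy => ?_⟩
  · obtain ⟨h1, h2, h3, e', he'⟩ := hy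
    have h5 : ContDiffAt ℝ ∞ R.symm (χ y) := by
      refine R.contDiffAt_symm (f₀' := e') h2 ?_ (hΦs _ h3)
      rw [he']
      exact ((hΦs _ h3).differentiableAt (by simp)).hasFDerivAt
    exact (h5.contMDiffAt.comp y ((contMDiffOn_chart (I := 𝓘(ℝ, E)) (x := q)).contMDiffAt
      (χ.open_source.mem_nhds h1))).contMDiffWithinAt
  · obtain ⟨h1, h2, h3, -⟩ := hy
    exact χ.injOn h3 h1 (R.right_inv h2)

end LocalTransitivity

end HamiltonianFamily

/-! ### Tracing out a curve by Hamiltonian diffeomorphisms. -/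

section Transport

universe u

variable {E : Type u} [NormedAddCommGroup E] [NormedSpace ℝ E]
  {M : Type*} [TopologicalSpace M] [ChartedSpace E M] [FiniteDimensional ℝ E]
  [IsManifold 𝓘(ℝ, E) ∞ M] [T2Space M] [CompactSpace M]

variable (E) in
/-- The part of the curve `σ` over `[0, c]` is traced out by a smooth family of Hamiltonian
diffeomorphisms. -/
def IsTransportedUpTo (Ω : SymplecticForm E M) (σ : ℝ → M) (c : ℝ) : Prop :=
  ∃ g : ℝ → Equiv.Perm M, IsHamFamilyOn ℝ Ω (Set.Icc 0 c) g ∧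
    ∀ t ∈ Set.Icc 0 c, g t (σ 0) = σ t

omit [IsManifold 𝓘(ℝ, E) ∞ M] [T2Space M] [CompactSpace M] in
/-- A family tracing out `σ` up to time `c` extends over intervals on which `σ` stays in an open
set of points reachable from a single point. -/
lemma IsTransportedUpTo.extend {Ω : SymplecticForm E M} {σ : ℝ → M} {c d a₀ : ℝ} {q : M}
    {U : Set M} {Λ : M → Equiv.Perm M} (hσ : ContMDiffOn 𝓘(ℝ, ℝ) 𝓘(ℝ, E) ∞ σ (Set.Icc 0 d))
    (hΛ : IsHamFamilyOn E Ω U Λ) (hΛq : ∀ y ∈ U, Λ y q = y) (hc : 0 ≤ c) (hcd : c ≤ d)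
    (ha₀ : a₀ < c) (hU : ∀ t ∈ Set.Icc 0 d, a₀ < t → σ t ∈ U)
    (h : IsTransportedUpTo E Ω σ c) : IsTransportedUpTo E Ω σ d := by
  -- For c = 0 there is no room for a cutoff strictly between 0 and c; but then the whole curve over
  -- [0, d] lies in U and Λ alone suffices.
  rcases hc.eq_or_lt with rfl | hc
  · have hU' : ∀ t ∈ Set.Icc 0 d, σ t ∈ U := fun t ht => hU t ht (ha₀.trans_le ht.1)
    have h0 := hU' 0 ⟨le_rfl, hcd⟩
    refine ⟨fun t => Λ (σ t) * (Λ (σ 0))⁻¹, (hΛ.comp hσ hU').mul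
      (isHamFamilyOn_const ℝ (inv_mem (hΛ.mem _ h0)) _), fun t ht => ?_⟩
    have h1 : (Λ (σ 0))⁻¹ (σ 0) = q := Equiv.Perm.inv_eq_iff_eq.2 (hΛq _ h0).symm
    rw [Equiv.Perm.mul_apply, h1, hΛq _ (hU' t ht)]
  obtain ⟨g, hg, hgσ⟩ := h
  obtain ⟨a, ha, hac⟩ := exists_between (max_lt hc ha₀)
  rw [max_lt_iff] at ha
  let χ : ℝ → ℝ := fun t => Real.smoothTransition ((t - a) / (c - a))
  -- A smooth clock that equals t up to a, never exceeds c, and is back at a from c on. The family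
  -- Λ(σ t) Λ(σ(τ t))⁻¹ g(τ t) sends σ 0 to σ(τ t), then to q, then to σ t. It coincides with g up
  -- to a and uses g only on [0, c], so no corner appears.
  let τ : ℝ → ℝ := fun t => t + χ t * (a - t)
  have hac' : 0 < c - a := sub_pos.2 hac
  have hχ : ContDiff ℝ ∞ χ := Real.smoothTransition.contDiff.comp
    ((contDiff_id.sub contDiff_const).div_const _)
  have hτ : ContDiff ℝ ∞ τ := contDiff_id.add (hχ.mul (contDiff_const.sub contDiff_id))
  have hτ1 : ∀ t ≤ a, τ t = t := fun t ht => by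
    have : χ t = 0 := Real.smoothTransition.zero_of_nonpos
      (div_nonpos_of_nonpos_of_nonneg (by linarith) hac'.le)
    simp [τ, this]
  have hτ2 : ∀ t, a ≤ t → a ≤ τ t := fun t ht => by
    have : χ t ≤ 1 := Real.smoothTransition.le_one _
    simp only [τ]
    nlinarith
  have hτ3 : ∀ t, τ t ≤ c := fun t => by
    have h0 : 0 ≤ χ t := Real.smoothTransition.nonneg _
    rcases le_total t a with h | h
    · rw [hτ1 t h]; linarith
    rcases le_total t c with h' | h'
    · simp only [τ]
      nlinarith
    · have : χ t = 1 := Real.smoothTransition.one_of_one_le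
        ((one_le_div hac').2 (by linarith))
      simp only [τ, this]
      linarith
  have hτ4 : ∀ t, 0 ≤ t → 0 ≤ τ t := fun t ht => by
    rcases le_total t a with h | h
    · rwa [hτ1 t h]
    · exact ha.1.le.trans (hτ2 t h)
  have hτ5 : ∀ t, a₀ < t → a₀ < τ t := fun t ht => by
    rcases le_total t a with h | h
    · rwa [hτ1 t h]
    · exact ha.2.trans_le (hτ2 t h)
  have hτI : ∀ t ∈ Set.Icc 0 d, τ t ∈ Set.Icc 0 c := fun t ht => ⟨hτ4 t ht.1, hτ3 t⟩
  have hτI' : ∀ t ∈ Set.Icc 0 d, τ t ∈ Set.Icc 0 d := fun t ht =>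
    ⟨hτ4 t ht.1, (hτ3 t).trans hcd⟩
  refine ⟨fun t => Λ (σ t) * (Λ (σ (τ t)))⁻¹ * g (τ t), ?_, fun t ht => ?_⟩
  · refine IsHamFamilyOn.of_union (isOpen_Iio (a := a)) (isOpen_Ioi (a := a₀)) ?_ ?_ fun t _ => ?_
    · refine (hg.mono ?_).congr fun t ht => ?_
      · rintro t ⟨ht, hta⟩
        exact ⟨ht.1, (le_of_lt hta).trans hac.le⟩
      · rw [hτ1 t (le_of_lt ht.2), mul_inv_cancel, one_mul]
    · have h1 := hΛ.comp (hσ.mono (Set.inter_subset_left (t := Set.Ioi a₀)))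
        fun t ht => hU t ht.1 ht.2
      have h2 : IsHamFamilyOn ℝ Ω (Set.Icc 0 d ∩ Set.Ioi a₀) (fun t => Λ (σ (τ t))) :=
        h1.comp hτ.contMDiff.contMDiffOn fun t ht => ⟨hτI' t ht.1, hτ5 t ht.2⟩
      have h3 : IsHamFamilyOn ℝ Ω (Set.Icc 0 d ∩ Set.Ioi a₀) (fun t => g (τ t)) :=
        hg.comp hτ.contMDiff.contMDiffOn fun t ht => hτI t ht.1
      exact (h1.mul h2.inv).mul h3
    · rcases lt_or_ge t a with h | h
      · exact Or.inl h
      · exact Or.inr (ha.2.trans_le h)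
  · rw [Equiv.Perm.mul_apply, hgσ _ (hτI t ht)]
    rcases lt_or_ge t a with h | h
    · rw [hτ1 t h.le, mul_inv_cancel]
      rfl
    · have h0 : a₀ < t := ha.2.trans_le h
      have h1 : (Λ (σ (τ t)))⁻¹ (σ (τ t)) = q :=
        Equiv.Perm.inv_eq_iff_eq.2 (hΛq _ (hU _ (hτI' t ht) (hτ5 t h0))).symm
      rw [Equiv.Perm.mul_apply, h1, hΛq _ (hU t ht h0)]

omit [IsManifold 𝓘(ℝ, E) ∞ M] [T2Space M] [CompactSpace M] in
lemma IsTransportedUpTo.mono {Ω : SymplecticForm E M} {σ : ℝ → M} {c d : ℝ} (hcd : c ≤ d)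
    (h : IsTransportedUpTo E Ω σ d) : IsTransportedUpTo E Ω σ c := by
  obtain ⟨g, hg, hgσ⟩ := h
  exact ⟨g, hg.mono (Set.Icc_subset_Icc_right hcd), fun t ht => hgσ t ⟨ht.1, ht.2.trans hcd⟩⟩

/-- Every smooth curve is the trajectory of a point under a smooth family of Hamiltonian
diffeomorphisms. -/
theorem exists_hamFamily_transport (Ω : SymplecticForm E M) {σ : ℝ → M}
    (hσ : ContMDiffOn 𝓘(ℝ, ℝ) 𝓘(ℝ, E) ∞ σ (Set.Icc 0 1)) :
    ∃ g : ℝ → Equiv.Perm M, IsHamFamilyOn ℝ Ω (Set.Icc 0 1) g ∧ g 0 = 1 ∧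
      ∀ t ∈ Set.Icc (0 : ℝ) 1, g t (σ 0) = σ t := by
  -- Being reachable up to time c is a locally constant property of c, hence constant on the
  -- connected interval.
  have hall : IsTransportedUpTo E Ω σ 0 ↔ IsTransportedUpTo E Ω σ 1 := by
    refine isPreconnected_Icc.induction₂ (s := Set.Icc (0 : ℝ) 1)
      (fun c d => IsTransportedUpTo E Ω σ c ↔ IsTransportedUpTo E Ω σ d) (fun t₀ ht₀ => ?_)
      (fun _ _ _ _ _ _ h h' => h.trans h') (fun _ _ _ _ h => h.symm)
      (Set.left_mem_Icc.2 zero_le_one) (Set.right_mem_Icc.2 zero_le_one)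
    obtain ⟨U, hU, Λ, hΛ, hΛq⟩ := exists_local_motion Ω (σ t₀)
    have h1 : σ ⁻¹' U ∈ 𝓝[Set.Icc 0 1] t₀ := (hσ.continuousOn t₀ ht₀).preimage_mem_nhdsWithin hU
    obtain ⟨ε, hε, hsub⟩ := Metric.mem_nhdsWithin_iff.1 h1
    have hext : ∀ c ∈ Set.Icc (0 : ℝ) 1, ∀ d ∈ Set.Icc (0 : ℝ) 1, t₀ - ε < c → d < t₀ + ε →
        c ≤ d → IsTransportedUpTo E Ω σ c → IsTransportedUpTo E Ω σ d :=
      fun c hc d hd hcε hdε hcd => IsTransportedUpTo.extend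
        (hσ.mono (Set.Icc_subset_Icc_right hd.2)) hΛ hΛq hc.1 hcd hcε fun t ht hta => hsub
          ⟨by rw [Metric.mem_ball, Real.dist_eq, abs_lt]; constructor <;> linarith [ht.2],
            ht.1, ht.2.trans hd.2⟩
    filter_upwards [self_mem_nhdsWithin, mem_nhdsWithin_of_mem_nhds (Metric.ball_mem_nhds t₀ hε)]
      with c hc hcε
    rw [Metric.mem_ball, Real.dist_eq, abs_lt] at hcε
    rcases le_total t₀ c with h | h
    · exact ⟨hext t₀ ht₀ c hc (by linarith) (by linarith) h, .mono h⟩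
    · exact ⟨.mono h, hext c hc t₀ ht₀ (by linarith) (by linarith) h⟩
  have h0 : IsTransportedUpTo E Ω σ 0 := ⟨fun _ => 1, isHamFamilyOn_const ℝ (one_mem _) _,
    fun t ht => by rw [le_antisymm ht.2 ht.1]; rfl⟩
  obtain ⟨g, hg, hgσ⟩ := hall.1 h0
  have h01 : (0 : ℝ) ∈ Set.Icc (0 : ℝ) 1 := Set.left_mem_Icc.2 zero_le_one
  -- Normalize to start at the identity; the trajectory is unchanged because g 0 fixes σ 0.
  refine ⟨fun t => g t * (g 0)⁻¹, hg.mul (isHamFamilyOn_const ℝ (inv_mem (hg.mem 0 h01)) _),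
    mul_inv_cancel _, fun t ht => ?_⟩
  rw [Equiv.Perm.mul_apply, Equiv.Perm.inv_eq_iff_eq.2 (hgσ 0 h01).symm, hgσ t ht]

end Transport

/-! ### Realizing linear symplectic maps as derivatives at a fixed point. -/

section Linearization

universe u

variable {E : Type u} [NormedAddCommGroup E] [NormedSpace ℝ E]
  {M : Type*} [TopologicalSpace M] [ChartedSpace E M]

/-- The symplectic bilinear form on a tangent space, as a bilinear map. -/
def linForm (Ω : SymplecticForm E M) (p : M) : E →ₗ[ℝ] E →ₗ[ℝ] ℝ :=
  LinearMap.mk₂ ℝ (fun u v => bilinAt Ω p u v) (by simp) (by simp) (by simp) (by simp)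

variable [FiniteDimensional ℝ E] [IsManifold 𝓘(ℝ, E) ∞ M] [T2Space M] [CompactSpace M]

/-- `B` is the derivative at `p` of the end point of a smooth family of Hamiltonian
diffeomorphisms fixing `p`. -/
def IsHamLinearization (Ω : SymplecticForm E M) (p : M) (B : E → E) : Prop :=
  ∃ b : ℝ → Equiv.Perm M, IsHamFamilyOn ℝ Ω Set.univ b ∧ b 0 = 1 ∧ (∀ t, b t p = p) ∧
    ∀ u, tderiv E E (b 1) p u = B u

omit [FiniteDimensional ℝ E] [IsManifold 𝓘(ℝ, E) ∞ M] [T2Space M] [CompactSpace M] in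
lemma tderiv_const_mul_sq {f : M → ℝ} {x : M} (hf : MDifferentiableAt 𝓘(ℝ, E) 𝓘(ℝ, ℝ) f x)
    (k : ℝ) (u : E) :
    tderiv E ℝ (fun x => k * f x ^ 2) x u = 2 * k * f x * tderiv E ℝ f x u := by
  have h1 : HasDerivAt (fun y : ℝ => k * y ^ 2) (2 * k * f x) (f x) := by
    refine ((hasDerivAt_pow 2 (f x)).const_mul k).congr_deriv ?_
    push_cast
    ring
  rw [tderiv_comp_apply (g := fun y : ℝ => k * y ^ 2)
    h1.differentiableAt.mdifferentiableAt hf, tderiv_eq_fderiv, h1.hasFDerivAt.fderiv]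
  change tderiv E ℝ f x u * (2 * k * f x) = _
  ring

/-- The flow of `k f²` is the flow of `f` with speed rescaled on level sets of `f`. -/
lemma hamFlow_const_mul_sq {Ω : SymplecticForm E M} {f : M → ℝ}
    (hf : ContMDiff 𝓘(ℝ, E) 𝓘(ℝ, ℝ) ∞ f) {k : ℝ}
    (hh : ContMDiff 𝓘(ℝ, E) 𝓘(ℝ, ℝ) ∞ (fun x => k * f x ^ 2)) (s : ℝ) (x : M) :
    hamFlow Ω hh s x = hamFlow Ω hf (s * (2 * k * f x)) x := by
  have h1 : ∀ y, hamVec Ω (fun x => k * f x ^ 2) y = (2 * k * f y) • hamVec Ω f y := fun y => by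
    refine (eq_hamVec fun v => ?_).symm
    rw [map_smul, smul_apply, bilinAt_hamVec,
      tderiv_const_mul_sq (hf.mdifferentiable (by simp) y), smul_eq_mul, mul_neg]
  have h2 : IsMIntegralCurve (fun s => hamFlow Ω hf (s * (2 * k * f x)) x)
      (hamField Ω (fun x => k * f x ^ 2)) := fun s => by
    have h3 := HasVelocityAt.comp (c := fun s => hamFlow Ω hf s x)
      (a := fun s => s * (2 * k * f x)) (isMIntegralCurve_hamFlow (Ω := Ω) hf x _)
      (hasDerivAt_mul_const (x := s) (2 * k * f x))
    have h4 := h1 (hamFlow Ω hf (s * (2 * k * f x)) x)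
    -- Conservation of f makes the speed factor 2 k f constant along each orbit, so a linear time
    -- change suffices.
    rw [apply_hamFlow (h := f) hf] at h4
    change HasVelocityAt _ (hamVec Ω (fun x => k * f x ^ 2) _) s
    rw [h4]
    exact h3
  have h5 := eq_hamFlow hh h2 s
  simp only [zero_mul, hamFlow_zero] at h5
  exact h5.symm

/-- Take f with f(p) = 0 and Hamiltonian vector v at p, and the Hamiltonian -(c/2) f². Its time-one
map sends x to the f-flow of x at time -c f(x). It fixes p, and its derivative there is u ↦ u - c
df(u) v = u + c Ω(v, u) v. -/
lemma isHamLinearization_transvection (Ω : SymplecticForm E M) (p : M) (v : E) (c : ℝ) :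
    IsHamLinearization Ω p (fun u => u + (c * bilinAt Ω p v u) • v) := by
  obtain ⟨f, hf, hfp, hfv⟩ := exists_contMDiff_tderiv_eq p (-bilinAt Ω p v)
  have hv : v = hamVec Ω f p := eq_hamVec fun w => by rw [hfv]; simp
  have hh : ContMDiff 𝓘(ℝ, E) 𝓘(ℝ, ℝ) ∞ (fun x => -c / 2 * f x ^ 2) :=
    contMDiff_const.mul (hf.pow 2)
  have hflow := hamFlow_const_mul_sq (Ω := Ω) hf hh
  refine ⟨fun s => hamPerm Ω hh s, isHamFamilyOn_hamPerm hh, ?_, fun t => ?_, fun u => ?_⟩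
  · ext x
    exact hamFlow_zero hh x
  · change hamFlow Ω hh t p = p
    rw [hflow, hfp, mul_zero, mul_zero, hamFlow_zero]
  · have h1 : (fun x => hamFlow Ω hh 1 x) = fun x => hamFlow Ω hf (-c * f x) x := funext fun x => by
      rw [hflow]
      congr 1
      ring
    have h2 : HasVelocityAt (fun s => hamFlow Ω hf s p) v 0 := by
      have h3 : v = hamVec Ω f (hamFlow Ω hf 0 p) := by rw [hamFlow_zero]; exact hv
      rw [h3]
      exact isMIntegralCurve_hamFlow (Ω := Ω) hf p 0
    have hfd : MDifferentiableAt 𝓘(ℝ, E) 𝓘(ℝ, ℝ) f p := hf.mdifferentiable (by simp) p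
    have hcf : MDifferentiableAt 𝓘(ℝ, E) 𝓘(ℝ, ℝ) (fun x => -c * f x) p :=
      (contMDiff_const.mul hf).mdifferentiable (by simp) p
    have hG : MDifferentiableAt (𝓘(ℝ, ℝ).prod 𝓘(ℝ, E)) 𝓘(ℝ, E)
        (fun q : ℝ × M => hamFlow Ω hf q.1 q.2) (-c * f p, p) :=
      (contMDiff_hamFlow hf).mdifferentiable (by simp) _
    have h4 : HasMFDerivAt 𝓘(ℝ, E) (𝓘(ℝ, ℝ).prod 𝓘(ℝ, E)) (fun x => (-c * f x, x)) p
        ((mfderiv 𝓘(ℝ, E) 𝓘(ℝ, ℝ) (fun x => -c * f x) p).prod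
          (ContinuousLinearMap.id ℝ (TangentSpace 𝓘(ℝ, E) p))) :=
      hcf.hasMFDerivAt.prodMk (hasMFDerivAt_id p)
    have h5 := (HasMFDerivAt.comp (f := fun x => (-c * f x, x))
      (g := fun q : ℝ × M => hamFlow Ω hf q.1 q.2) p hG.hasMFDerivAt h4).mfderiv
    have h6 : tderiv E E (fun x => hamFlow Ω hf (-c * f x) x) p u =
        mfderiv (𝓘(ℝ, ℝ).prod 𝓘(ℝ, E)) 𝓘(ℝ, E) (fun q : ℝ × M => hamFlow Ω hf q.1 q.2)
          (-c * f p, p) (tderiv E ℝ (fun x => -c * f x) p u, u) := DFunLike.congr_fun h5 u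
    have h7 : mfderiv (𝓘(ℝ, ℝ).prod 𝓘(ℝ, E)) 𝓘(ℝ, E) (fun q : ℝ × M => hamFlow Ω hf q.1 q.2)
          (-c * f p, p) (tderiv E ℝ (fun x => -c * f x) p u, u) =
        tderiv ℝ E (fun s => hamFlow Ω hf s p) (-c * f p) (tderiv E ℝ (fun x => -c * f x) p u) +
          tderiv E E (fun x => hamFlow Ω hf (-c * f p) x) p u := mfderiv_prod_eq_add_apply hG
    have h8 : (fun x => hamFlow Ω hf 0 x) = fun x => x := funext fun x => hamFlow_zero hf x
    change tderiv E E (fun x => hamFlow Ω hh 1 x) p u = _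
    rw [h1, h6, h7, hfp, mul_zero, h8, tderiv_id, tderiv_of_hasVelocityAt h2,
      tderiv_const_mul hfd, hfv, add_comm]
    simp

omit [T2Space M] [CompactSpace M] [IsManifold 𝓘(ℝ, E) ∞ M] in
lemma mdifferentiableAt_of_mem {Ω : SymplecticForm E M} {g : Equiv.Perm M} (hg : g ∈ hamGroup Ω)
    (x : M) : MDifferentiableAt 𝓘(ℝ, E) 𝓘(ℝ, E) g x :=
  hg.1.smooth.mdifferentiable (by simp) x

/-- Every linear symplectic map of a tangent space is the derivative of a Hamiltonian
diffeomorphism, in a smooth family fixing the base point. -/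
theorem isHamLinearization_of_preservesForm (Ω : SymplecticForm E M) (p : M) (B : E ≃ₗ[ℝ] E)
    (hB : PreservesForm (linForm Ω p) B) : IsHamLinearization Ω p B := by
  -- Families fixing p can be multiplied and inverted, so the generators suffice.
  have hmem := mem_closure_transvections (η := linForm Ω p) (fun u => bilinAt_self Ω p u)
    (fun u hu => bilinAt_nondegenerate Ω p hu) B hB
  clear hB
  induction hmem using Subgroup.closure_induction with
  | mem T hT =>
    obtain ⟨v, c, hT⟩ := hT
    have h := isHamLinearization_transvection Ω p v c
    rwa [show (T : E → E) = fun u => u + (c * bilinAt Ω p v u) • v from funext hT]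
  | one => exact ⟨fun _ => 1, isHamFamilyOn_const ℝ (one_mem _) _, rfl, fun _ => rfl,
      fun u => DFunLike.congr_fun (tderiv_id p) u⟩
  | mul A B _ _ hA hB =>
    obtain ⟨a, ha, ha0, hap, haA⟩ := hA
    obtain ⟨b, hb, hb0, hbp, hbB⟩ := hB
    refine ⟨fun t => a t * b t, ha.mul hb, by simp only [ha0, hb0, mul_one], fun t => ?_,
      fun u => ?_⟩
    · rw [Equiv.Perm.mul_apply, hbp, hap]
    · change tderiv E E (fun x => a 1 (b 1 x)) p u = A (B u)
      rw [tderiv_comp_apply (mdifferentiableAt_of_mem (ha.mem 1 trivial) _)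
        (mdifferentiableAt_of_mem (hb.mem 1 trivial) _), hbp, haA, hbB]
  | inv A _ hA =>
    obtain ⟨a, ha, ha0, hap, haA⟩ := hA
    have hap' : ∀ t, (a t)⁻¹ p = p := fun t => Equiv.Perm.inv_eq_iff_eq.2 (hap t).symm
    refine ⟨fun t => (a t)⁻¹, ha.inv, by simp only [ha0, inv_one], hap', fun u => ?_⟩
    have h1 : tderiv E E (fun x => (a 1)⁻¹ (a 1 x)) p (A⁻¹ u) = A⁻¹ u := by
      have h2 : (fun x => (a 1)⁻¹ (a 1 x)) = fun x => x := funext fun x => (a 1).symm_apply_apply x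
      rw [h2, tderiv_id]
      rfl
    rw [tderiv_comp_apply (mdifferentiableAt_of_mem (inv_mem (ha.mem 1 trivial)) _)
      (mdifferentiableAt_of_mem (ha.mem 1 trivial) _), hap, haA] at h1
    rwa [show A (A⁻¹ u) = u from A.apply_symm_apply u] at h1

end Linearization

/-! ### Assembling the deformation. -/

section Main

universe u

variable {E : Type u} [NormedAddCommGroup E] [NormedSpace ℝ E]
  {M : Type*} [TopologicalSpace M] [ChartedSpace E M]

/-- The derivative of a symplectic map at a fixed point is a linear symplectic isomorphism. -/
lemma exists_linearEquiv_of_isSymplectic [FiniteDimensional ℝ E] {Ω : SymplecticForm E M}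
    {f : M → M} {p : M} (hf : IsSymplectic Ω f) (hp : f p = p) :
    ∃ A : E ≃ₗ[ℝ] E, PreservesForm (linForm Ω p) A ∧ ∀ u, A u = tderiv E E f p u := by
  have h1 : ∀ u v, bilinAt Ω p (tderiv E E f p u) (tderiv E E f p v) = bilinAt Ω p u v :=
    fun u v => by
      have := isSymplectic_iff.1 hf p u v
      rwa [hp] at this
  have hinj : Function.Injective (tderiv E E f p : E →ₗ[ℝ] E) := by
    rw [← LinearMap.ker_eq_bot, LinearMap.ker_eq_bot']
    intro u hu
    refine bilinAt_nondegenerate Ω p fun v => ?_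
    have hu' : tderiv E E f p u = 0 := hu
    rw [← h1, hu', map_zero]
    rfl
  exact ⟨LinearEquiv.ofInjectiveEndo _ hinj, fun u v => h1 u v, fun u => rfl⟩

variable [FiniteDimensional ℝ E]

/-- The diffeomorphism underlying an element of the group of Hamiltonian diffeomorphisms. -/
def hamDiffeo {Ω : SymplecticForm E M} {g : Equiv.Perm M} (hg : g ∈ hamGroup Ω) :
    M ≃ₘ⟮𝓘(ℝ, E), 𝓘(ℝ, E)⟯ M where
  toEquiv := g
  contMDiff_toFun := hg.1.smooth
  contMDiff_invFun := hg.2.smooth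

/-- Composing a symplectic isotopy with a smooth family of Hamiltonian diffeomorphisms gives a
Hamiltonian deformation of it. -/
lemma exists_hamiltonianDeformation {Ω : SymplecticForm E M}
    {ψ : ℝ → M ≃ₘ⟮𝓘(ℝ, E), 𝓘(ℝ, E)⟯ M} (hψ : IsSymplecticIsotopy Ω ψ) {k : ℝ → Equiv.Perm M}
    (hk : IsHamFamilyOn ℝ Ω (Set.Icc 0 1) k) (hk0 : k 0 = 1) :
    ∃ φ : ℝ → M ≃ₘ⟮𝓘(ℝ, E), 𝓘(ℝ, E)⟯ M, IsSymplecticIsotopy Ω φ ∧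
      IsHamiltonianDeformation Ω φ ψ ∧ ∀ t ∈ Set.Icc (0 : ℝ) 1, ∀ x, φ t x = k t (ψ t x) := by
  classical
  let φ : ℝ → M ≃ₘ⟮𝓘(ℝ, E), 𝓘(ℝ, E)⟯ M := fun t =>
    if ht : t ∈ Set.Icc (0 : ℝ) 1 then (ψ t).trans (hamDiffeo (hk.mem t ht)) else ψ t
  have hφ : ∀ t ∈ Set.Icc (0 : ℝ) 1, ∀ x, φ t x = k t (ψ t x) := fun t ht x => by
    simp only [φ, dif_pos ht]
    rfl
  have h0 : (0 : ℝ) ∈ Set.Icc (0 : ℝ) 1 := Set.left_mem_Icc.2 zero_le_one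
  refine ⟨φ, ⟨?_, fun t ht => ?_, fun x => ?_⟩, fun t ht => ?_, hφ⟩
  · exact (hk.smooth.comp (contMDiffOn_fst.prodMk hψ.smooth)
      fun q hq => ⟨hq.1, trivial⟩).congr fun q hq => hφ q.1 hq.1 q.2
  · have h1 : (φ t : M → M) = fun x => k t (ψ t x) := funext (hφ t ht)
    rw [h1]
    exact (hk.mem t ht).1.symplectic.comp (hψ.symplectic t ht)
      (mdifferentiableAt_of_mem (hk.mem t ht)) ((ψ t).mdifferentiable (by simp))
  · rw [hφ 0 h0, hk0, hψ.zero]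
    rfl
  · have h1 : (fun x => φ t ((ψ t).symm x)) = k t := funext fun x => by
      rw [hφ t ht, (ψ t).apply_symm_apply]
    rw [h1]
    exact isHamiltonianDiffeo_of_mem (hk.mem t ht)

variable [IsManifold 𝓘(ℝ, E) ∞ M] [T2Space M] [CompactSpace M]

/-- A symplectic isotopy of a closed manifold has a Hamiltonian deformation for which a given smooth
loop is a hyperbolic one-periodic orbit. The loop need not be contractible. -/
theorem exists_hamiltonianDeformation_hyperbolic (Ω : SymplecticForm E M)
    {ψ : ℝ → M ≃ₘ⟮𝓘(ℝ, E), 𝓘(ℝ, E)⟯ M} (hψ : IsSymplecticIsotopy Ω ψ)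
    {γ : C(UnitAddCircle, M)} (hγ : IsSmoothLoop E γ) :
    ∃ φ : ℝ → M ≃ₘ⟮𝓘(ℝ, E), 𝓘(ℝ, E)⟯ M, IsSymplecticIsotopy Ω φ ∧
      IsHamiltonianDeformation Ω φ ψ ∧ IsHyperbolicOnePeriodicOrbit φ γ := by
  set p := γ 0 with hp
  have h11 : (1 : ℝ) ∈ Set.Icc (0 : ℝ) 1 := Set.right_mem_Icc.2 zero_le_one
  have hγ1 : γ ((1 : ℝ) : UnitAddCircle) = p := by rw [AddCircle.coe_period]
  have hγ0 : γ ((0 : ℝ) : UnitAddCircle) = p := rfl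
  have hσ : ContMDiffOn 𝓘(ℝ, ℝ) 𝓘(ℝ, E) ∞ (fun t => ψ t p) (Set.Icc 0 1) :=
    hψ.smooth.comp (contMDiffOn_id.prodMk contMDiffOn_const) fun t ht => ⟨ht, trivial⟩
  obtain ⟨g, hg, hg0, hgσ⟩ := exists_hamFamily_transport Ω hσ
  obtain ⟨g', hg', hg'0, hg'γ⟩ := exists_hamFamily_transport Ω hγ.contMDiffOn
  simp only [hψ.zero] at hgσ
  simp only [hγ0] at hg'γ
  have hgψ : ∀ t ∈ Set.Icc (0 : ℝ) 1, (g t)⁻¹ (ψ t p) = p := fun t ht =>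
    Equiv.Perm.inv_eq_iff_eq.2 (hgσ t ht).symm
  have hψ1 : MDifferentiable 𝓘(ℝ, E) 𝓘(ℝ, E) (ψ 1) := (ψ 1).mdifferentiable (by simp)
  have hgi := inv_mem (hg.mem 1 h11)
  -- C and D' are the derivatives at p of g_1⁻¹ ∘ ψ_1 and of g'_1; the latter fixes p because the
  -- loop closes up.
  obtain ⟨C, hCf, hC⟩ := exists_linearEquiv_of_isSymplectic (p := p)
    (hgi.1.symplectic.comp (hψ.symplectic 1 h11) (mdifferentiableAt_of_mem hgi) hψ1)
    (hgψ 1 h11)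
  have hg'p : g' 1 p = p := by rw [hg'γ 1 h11, hγ1]
  obtain ⟨D', hDf', hD'⟩ := exists_linearEquiv_of_isSymplectic (p := p)
    (hg'.mem 1 h11).1.symplectic hg'p
  obtain ⟨D, hDf, hD⟩ := exists_hyperbolic_linearEquiv (η := linForm Ω p)
    (fun u => bilinAt_self Ω p u) (fun u hu => bilinAt_nondegenerate Ω p hu)
  -- The derivative of b_1 is prescribed as D'⁻¹ ∘ D ∘ C⁻¹, to cancel the linear parts contributed
  -- by g'_1 and by g_1⁻¹ ∘ ψ_1 and leave D.
  obtain ⟨b, hb, hb0, hbp, hbB⟩ := isHamLinearization_of_preservesForm Ω p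
    ((C.symm.trans D).trans D'.symm) fun u v => by
      have h1 := hDf' (D'.symm (D (C.symm u))) (D'.symm (D (C.symm v)))
      have h2 := hCf (C.symm u) (C.symm v)
      rw [D'.apply_symm_apply, D'.apply_symm_apply, hDf] at h1
      rw [C.apply_symm_apply, C.apply_symm_apply] at h2
      exact h1.symm.trans h2.symm
  obtain ⟨φ, hφ, hφψ, hφk⟩ := exists_hamiltonianDeformation hψ
    ((hg'.mul (hb.mono (Set.subset_univ _))).mul hg.inv) (by simp [hg0, hg'0, hb0])
  have htraj : ∀ t ∈ Set.Icc (0 : ℝ) 1, γ (t : UnitAddCircle) = φ t p := fun t ht => by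
    rw [hφk t ht, Equiv.Perm.mul_apply, Equiv.Perm.mul_apply, hgψ t ht, hbp, hg'γ t ht]
  have hfix : φ 1 p = p := by rw [← htraj 1 h11, hγ1]
  have hder : ∀ u, tderiv E E (φ 1) p u = D u := fun u => by
    have h1 : (φ 1 : M → M) = fun x => g' 1 (b 1 ((g 1)⁻¹ (ψ 1 x))) := funext (hφk 1 h11)
    have hb1 := hb.mem 1 trivial
    have hk : MDifferentiableAt 𝓘(ℝ, E) 𝓘(ℝ, E) (fun x => (g 1)⁻¹ (ψ 1 x)) p :=
      (mdifferentiableAt_of_mem hgi _).comp p (hψ1 p)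
    rw [h1, tderiv_comp_apply (g := g' 1) (f := fun x => b 1 ((g 1)⁻¹ (ψ 1 x)))
        (mdifferentiableAt_of_mem (hg'.mem 1 h11) _)
        ((mdifferentiableAt_of_mem hb1 _).comp p hk),
      tderiv_comp_apply (g := b 1) (mdifferentiableAt_of_mem hb1 _) hk, hgψ 1 h11, hbp, hbB,
      ← hD', ← hC]
    simp
  refine ⟨φ, hφ, hφψ, htraj, hfix, fun z hz => ?_⟩
  refine norm_ne_one_of_hasEigenvalue_baseChange (V := E)
    (D := (fixedPointDeriv (E := E) (φ 1) p hfix).toLinearMap) (fun v => ?_) hz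
  change tderiv E E (φ 1) p (tderiv E E (φ 1) p v) = (5 / 2 : ℝ) • tderiv E E (φ 1) p v - v
  rw [hder, hder, hD]

end Main

end SymplecticIsotopy
end

theorem proposition1p2 (n : ℕ) {M : Type*} [TopologicalSpace M] [T2Space M] [CompactSpace M]
    [ChartedSpace (EuclideanSpace ℝ (Fin (2 * n))) M] [IsManifold (𝓡 (2 * n)) ∞ M]
    (Ω : SymplecticIsotopy.SymplecticForm (EuclideanSpace ℝ (Fin (2 * n))) M)
    (ψ : ℝ → M ≃ₘ⟮𝓡 (2 * n), 𝓡 (2 * n)⟯ M)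
    (hψ : SymplecticIsotopy.IsSymplecticIsotopy Ω ψ)
    (γ : C(UnitAddCircle, M))
    (hγ : SymplecticIsotopy.IsSmoothLoop (EuclideanSpace ℝ (Fin (2 * n))) γ)
    (hγ₀ : γ.Nullhomotopic) :
    ∃ φ : ℝ → M ≃ₘ⟮𝓡 (2 * n), 𝓡 (2 * n)⟯ M,
      SymplecticIsotopy.IsSymplecticIsotopy Ω φ ∧
      SymplecticIsotopy.IsHamiltonianDeformation Ω φ ψ ∧
      SymplecticIsotopy.IsHyperbolicOnePeriodicOrbit φ γ := by
  exact SymplecticIsotopy.exists_hamiltonianDeformation_hyperbolic Ω hψ hγ
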